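/- Let $M\subset\mathbb{C}^d$ be a bounded, connected, embedded complex submanifold, and put $\partial M:=\overline{M}\setminus M$. Let $\mathsf{k}_M$ be the Kobayashi distance and $\kappa_M$ the Kobayashi–Royden pseudometric of $M$ (normalized so that on the unit disc $\mathbb{D}$ the metric is $|dz|/(1-|z|^2)$). For $\lambda\ge 1$, $\kappa\geq 0$, a $(\lambda,\kappa)$-almost-geodesic is an absolutely continuous curve $\sigma:[a,b]\to M$ such that $\frac1\lambda|s-t|-\kappa\le \mathsf{k}_M(\sigma(s),\sigma(t))\le\lambda|s-t|+\kappa$ for all $s,t\in[a,b]$ and $\kappa_M(\sigma(t);\sigma'(t))\le\lambda$ for almost every $t$. A real Kobayashi geodesic is a map $\sigma:[a,b]\to M$ with $\mathsf{k}_M(\sigma(s),\sigma(t))=|s-t|$ for all $s,t\in[a,b]$. Say that a class $\mathcal{C}$ of curves in $M$ satisfies $(\ast)$ if for all $p\ne q$ in $\partial M$ there are neighbourhoods $V$ of $p$ and $W$ of $q$ in $\mathbb{C}^d$ with $\overline V\cap\overline W=\emptyset$ and a compact set $K\subset M$ such that every curve in $\mathcal{C}$ with initial point in $V$ and terminal point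 in $W$ meets $K$. For $\kappa>0$, $M$ has the visibility property with respect to $(1,\kappa)$-almost-geodesics if any two distinct points of $M$ can be joined by a $(1,\kappa)$-almost-geodesic and the $(1,\kappa)$-almost-geodesics satisfy $(\ast)$. $M$ is a BNT-visibility submanifold if $(M,\mathsf{k}_M)$ is Cauchy-complete and the real Kobayashi geodesics satisfy $(\ast)$. $M$ is taut if every sequence of holomorphic maps $\mathbb{D}\to M$ has a subsequence that either converges locally uniformly to a holomorphic map $\mathbb{D}\to M$ or is compactly divergent (that is, for all compact $H\subset\mathbb{D}$ and $K\subset M$, its members map $H$ into $M\setminus K$ from some index on). **Theorem.** Suppose that at least one of the following holds: - $M$ is taut and there exists $\kappa_0>0$ such that $M$ has the visibility property with respect to $(1,\kappa_0)$-almost-geodesics; - $M$ is a BNT-visibility submanifold. Let $F:M\to M$ be a holomorphic map, and let $F^\nu$ denote its $\nu$-th iterate. Then exactly one of the following holds: 1. for every $z\in M$, the set $\{F^\nu(z) : \nu\in\mathbb{Z}_{+}\}$ is a relatively compact subset of $M$; 2. there exists $\xi\in\partial M$ such that $\lim_{\nu\to\infty}F^\nu(z)=\xi$ for every $z\in M$,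 and this convergence is uniform on the compact subsets of $M$. -/

import Mathlib

open Set Filter Topology MeasureTheory

noncomputable section

namespace KobayashiVisibility

variable {d : ℕ}

/-- `M` is an embedded complex submanifold of `ℂ^d`: there is a dimension `n` such that near each of
its points some biholomorphism between open subsets of `ℂ^d` takes `M` to (an open piece of) an
`n`-dimensional complex linear subspace. -/
def IsEmbeddedComplexSubmanifold (M : Set (EuclideanSpace ℂ (Fin d))) : Prop :=
  ∃ n : ℕ, ∀ p ∈ M,
    ∃ (φ : OpenPartialHomeomorph (EuclideanSpace ℂ (Fin d)) (EuclideanSpace ℂ (Fin d)))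
      (L : Submodule ℂ (EuclideanSpace ℂ (Fin d))),
      Module.finrank ℂ L = n ∧ p ∈ φ.source ∧
      DifferentiableOn ℂ φ φ.source ∧ DifferentiableOn ℂ φ.symm φ.target ∧
      ∀ z ∈ φ.source, (z ∈ M ↔ φ z ∈ L)

/-- The boundary `∂M = closure M \ M`. -/
def bdry (M : Set (EuclideanSpace ℂ (Fin d))) : Set (EuclideanSpace ℂ (Fin d)) :=
  closure M \ M

/-- A self-map of `M` is holomorphic if it is locally the restriction of a holomorphic map defined
on an open subset of `ℂ^d`. -/
def IsHolomorphicSelfMap (M : Set (EuclideanSpace ℂ (Fin d))) (F : M → M) : Prop :=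
  ∀ p : M, ∃ (U : Set (EuclideanSpace ℂ (Fin d)))
    (G : EuclideanSpace ℂ (Fin d) → EuclideanSpace ℂ (Fin d)),
    IsOpen U ∧ (p : EuclideanSpace ℂ (Fin d)) ∈ U ∧ DifferentiableOn ℂ G U ∧
      ∀ q : M, (q : EuclideanSpace ℂ (Fin d)) ∈ U → G q = F q

/-- `f` restricts to a holomorphic map from the open unit disc into `M`. -/
def IsHolomorphicDisc (M : Set (EuclideanSpace ℂ (Fin d)))
    (f : ℂ → EuclideanSpace ℂ (Fin d)) : Prop :=
  DifferentiableOn ℂ f (Metric.ball 0 1) ∧ MapsTo f (Metric.ball 0 1) M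

/-- The Poincaré distance on the open unit disc, with infinitesimal form `|dz| / (1 - |z|²)`. -/
def poincareDist (z w : ℂ) : ℝ :=
  Real.artanh ‖(z - w) / (1 - (starRingEnd ℂ) w * z)‖

/-- The Kobayashi (pseudo)distance of `M`: the infimum of the Poincaré lengths of the chains of
holomorphic discs in `M` from `z` to `w`. -/
def kobayashiDist (M : Set (EuclideanSpace ℂ (Fin d))) (z w : EuclideanSpace ℂ (Fin d)) : ℝ :=
  sInf {ℓ : ℝ | ∃ (m : ℕ) (x : ℕ → EuclideanSpace ℂ (Fin d))
      (f : ℕ → ℂ → EuclideanSpace ℂ (Fin d)) (a b : ℕ → ℂ),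
      x 0 = z ∧ x m = w ∧
      (∀ i < m, IsHolomorphicDisc M (f i) ∧
        a i ∈ Metric.ball (0 : ℂ) 1 ∧ b i ∈ Metric.ball (0 : ℂ) 1 ∧
        f i (a i) = x i ∧ f i (b i) = x (i + 1)) ∧
      ℓ = ∑ i ∈ Finset.range m, poincareDist (a i) (b i)}

/-- The Kobayashi--Royden pseudometric `κ_M(z; v)`: the infimum of the `α > 0` for which there is a
holomorphic disc `f` in `M` with `f(0) = z` and `α f'(0) = v`. (It is finite exactly for
`z ∈ M` and `v` tangent to `M` at `z`.) -/
def kobayashiRoyden (M : Set (EuclideanSpace ℂ (Fin d))) (z v : EuclideanSpace ℂ (Fin d)) :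
    ENNReal :=
  sInf {r : ENNReal | ∃ (α : ℝ) (f : ℂ → EuclideanSpace ℂ (Fin d)),
    0 < α ∧ IsHolomorphicDisc M f ∧ f 0 = z ∧ (α : ℂ) • deriv f 0 = v ∧ r = ENNReal.ofReal α}

/-- `σ : [a, b] → M` is a real Kobayashi geodesic. -/
def IsRealGeodesic (M : Set (EuclideanSpace ℂ (Fin d))) (a b : ℝ)
    (σ : ℝ → EuclideanSpace ℂ (Fin d)) : Prop :=
  MapsTo σ (Icc a b) M ∧
    ∀ s ∈ Icc a b, ∀ t ∈ Icc a b, kobayashiDist M (σ s) (σ t) = |s - t|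

/-- `σ : [a, b] → M` is a `(lam, κ)`-almost-geodesic. -/
def IsAlmostGeodesic (M : Set (EuclideanSpace ℂ (Fin d))) (lam κ a b : ℝ)
    (σ : ℝ → EuclideanSpace ℂ (Fin d)) : Prop :=
  MapsTo σ (Icc a b) M ∧
    (∀ s ∈ Icc a b, ∀ t ∈ Icc a b,
      1 / lam * |t - s| - κ ≤ kobayashiDist M (σ t) (σ s) ∧
        kobayashiDist M (σ t) (σ s) ≤ lam * |t - s| + κ) ∧
    AbsolutelyContinuousOnInterval σ a b ∧
    ∀ᵐ t ∂(volume.restrict (Icc a b)),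
      kobayashiRoyden M (σ t) (deriv σ t) ≤ ENNReal.ofReal lam

/-- The bending condition for a class `𝒞` of curves `σ : [a, b] → M`: any two distinct boundary
points have neighbourhoods with disjoint closures such that all curves in the class that start in
the first one and end in the second one meet a common compact subset of `M`. -/
def CurvesBend (M : Set (EuclideanSpace ℂ (Fin d)))
    (𝒞 : ℝ → ℝ → (ℝ → EuclideanSpace ℂ (Fin d)) → Prop) : Prop :=
  ∀ p ∈ bdry M, ∀ q ∈ bdry M, p ≠ q →
    ∃ V ∈ 𝓝 p, ∃ W ∈ 𝓝 q, Disjoint (closure V) (closure W) ∧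
      ∃ K ⊆ M, IsCompact K ∧
        ∀ (a b : ℝ) (σ : ℝ → EuclideanSpace ℂ (Fin d)), a ≤ b → 𝒞 a b σ →
          σ a ∈ V → σ b ∈ W → ∃ t ∈ Icc a b, σ t ∈ K

/-- `M` has the visibility property with respect to `(lam, κ)`-almost-geodesics. -/
def IsVisibilitySubmanifold (M : Set (EuclideanSpace ℂ (Fin d))) (lam κ : ℝ) : Prop :=
  (∀ z ∈ M, ∀ w ∈ M, z ≠ w → ∃ (a b : ℝ) (σ : ℝ → EuclideanSpace ℂ (Fin d)),
    a ≤ b ∧ IsAlmostGeodesic M lam κ a b σ ∧ σ a = z ∧ σ b = w) ∧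
  CurvesBend M (IsAlmostGeodesic M lam κ)

/-- Every Cauchy sequence of `(M, k_M)` converges in `(M, k_M)`. -/
def IsKobayashiComplete (M : Set (EuclideanSpace ℂ (Fin d))) : Prop :=
  ∀ u : ℕ → EuclideanSpace ℂ (Fin d), (∀ n, u n ∈ M) →
    (∀ ε > 0, ∃ N : ℕ, ∀ m ≥ N, ∀ n ≥ N, kobayashiDist M (u m) (u n) < ε) →
    ∃ x ∈ M, Tendsto (fun n => kobayashiDist M (u n) x) atTop (𝓝 0)

/-- `M` is a BNT-visibility submanifold: it is Kobayashi complete and its real Kobayashi geodesics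
have the bending property. -/
def IsBNTVisibilitySubmanifold (M : Set (EuclideanSpace ℂ (Fin d))) : Prop :=
  IsKobayashiComplete M ∧ CurvesBend M (IsRealGeodesic M)

/-- `M` is taut: every sequence of holomorphic discs in `M` has a subsequence that either converges
locally uniformly to a holomorphic disc in `M` or is compactly divergent. -/
def IsTaut (M : Set (EuclideanSpace ℂ (Fin d))) : Prop :=
  ∀ f : ℕ → ℂ → EuclideanSpace ℂ (Fin d), (∀ n, IsHolomorphicDisc M (f n)) →
    ∃ φ : ℕ → ℕ, StrictMono φ ∧
      ((∃ g, IsHolomorphicDisc M g ∧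
          TendstoLocallyUniformlyOn (fun n => f (φ n)) g atTop (Metric.ball 0 1)) ∨
        ∀ H ⊆ Metric.ball (0 : ℂ) 1, IsCompact H → ∀ K ⊆ M, IsCompact K →
          ∀ᶠ n in atTop, Disjoint (f (φ n) '' H) K)

end KobayashiVisibility

end

/-!
The Kobayashi distance makes `M` a metric space with its usual topology (`KobayashiSpace M`): the
Schwarz lemma bounds it below by a multiple of the Euclidean distance, as `M` is bounded, and discs
in charts bound it above. Holomorphic self-maps are nonexpanding, so the theorem becomes a statement
about the iteration of a nonexpanding map of a locally compact metric space `X`, embedded in `ℂ^d`.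

*Visibility.* Both hypotheses give the same exact form of visibility (`IsVisibleEmbedding`): points
`x`, `y` of `X` near two distinct boundary points have a point `u` of a fixed compact set with
`d(x, u) + d(u, y) ≤ d(x, y)`. Chains of discs are traversed by curves that are almost minimal and
have unit speed for the Kobayashi–Royden metric; these are `(1, κ)`-almost-geodesics with an
arbitrarily small error, so that the error disappears in the limit
(`isVisibleEmbedding_of_almostGeodesics`). In the complete case the Hopf–Rinow theorem shows that
`X` is proper and geodesic (`isVisibleEmbedding_of_geodesics`).

*Dichotomy.* An orbit of a nonexpanding map either is relatively compact or leaves every compact set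
(`hasCompactOrbit_of_mapClusterPt`). Which of the two occurs does not depend on the starting point:
in a proper space this is clear, and in a taut submanifold it follows by applying tautness to the
images of a disc under the iterates (`hasCompactOrbit_of_isTaut`).

*Escaping orbits.* The limit of an escaping orbit along an ultrafilter does not depend on the
starting point. In a proper space this follows from visibility: two orbits stay at bounded distance
from each other, so if they had distinct limits they would return to a bounded set. For
almost-geodesics it holds because a short curve of unit speed is automatically a
`(1, κ)`-almost-geodesic: its images under the iterates are short and eventually avoid every compact
set, so their two ends cannot tend to distinct boundary points
(`hasCommonLimits_of_almostGeodesics`).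

*One limit.* Suppose that the orbit of `o` has two distinct limits `ξ` and `η`. If its points near
`η` had bounded distance from some point `x`, then moving `x` along its orbit towards `ξ` would not
increase this bound, and visibility would produce a point of a fixed compact set with a bound
smaller by a fixed amount, which is impossible for the infimum of all such bounds
(`not_eventually_dist_le`). Hence `d(o, f^n o)` tends to infinity, and comparing the orbit with the
times at which this distance is a record contradicts visibility (`orbit_limit_unique`).
-/

namespace KobayashiVisibility

/-! ### Iteration of nonexpanding maps of a locally compact metric space -/

section MetricDynamics

variable {X : Type*} [MetricSpace X] {f : X → X}

/-- The forward orbit of `x` under `f` stays in a compact set. -/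
def HasCompactOrbit (f : X → X) (x : X) : Prop :=
  ∃ K : Set X, IsCompact K ∧ ∀ n, f^[n] x ∈ K

/-- The forward orbit of `x` under `f` eventually leaves every compact set. -/
def OrbitEscapes (f : X → X) (x : X) : Prop :=
  ∀ K : Set X, IsCompact K → ∀ᶠ n in atTop, f^[n] x ∉ K

lemma dist_iterate_le (hf : LipschitzWith 1 f) (n : ℕ) (x y : X) :
    dist (f^[n] x) (f^[n] y) ≤ dist x y := by
  simpa using (hf.iterate n).dist_le_mul x y

lemma exists_dist_iterate_lt_of_mapClusterPt (hf : LipschitzWith 1 f) {x w : X}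
    (hw : MapClusterPt w atTop (fun n => f^[n] x)) {ε : ℝ} (hε : 0 < ε) (N : ℕ) :
    ∃ n ≥ N, dist (f^[n] w) w < ε := by
  have h := fun N => (mapClusterPt_iff_frequently.1 hw _
    (Metric.ball_mem_nhds w (half_pos hε))).forall_exists_of_atTop N
  obtain ⟨n, -, hn⟩ := h 0
  obtain ⟨m, hm, hm'⟩ := h (n + N)
  refine ⟨m - n, by omega, ?_⟩
  have h1 := dist_iterate_le hf (m - n) w (f^[n] x)
  rw [← Function.iterate_add_apply, Nat.sub_add_cancel (by omega), dist_comm w] at h1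
  have := dist_triangle (f^[m - n] w) (f^[m] x) w
  simp only [Metric.mem_ball] at hn hm'
  linarith

/-- A nonexpanding map is isometric on the orbit of a recurrent point. -/
lemma dist_iterate_le_of_recurrent (hf : LipschitzWith 1 f) {w : X}
    (hrec : ∀ ε > 0, ∀ N : ℕ, ∃ n ≥ N, dist (f^[n] w) w < ε) (k m : ℕ) :
    dist (f^[m] w) w ≤ dist (f^[k + m] w) (f^[k] w) := by
  refine le_of_forall_pos_le_add fun ε hε => ?_
  obtain ⟨n, hn, hn'⟩ := hrec (ε / 2) (half_pos hε) k
  have h1 := dist_iterate_le hf m w (f^[n] w)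
  have h2 := dist_iterate_le hf (n - k) (f^[k + m] w) (f^[k] w)
  simp only [← Function.iterate_add_apply] at h1 h2
  rw [show n - k + (k + m) = m + n by omega, show n - k + k = n by omega] at h2
  have := dist_triangle4 (f^[m] w) (f^[m + n] w) (f^[n] w) w
  rw [dist_comm w] at h1
  linarith

/-- The orbit of a recurrent point returns to a compact ball within bounded time, so it stays in
finitely many images of that ball. -/
lemma hasCompactOrbit_of_recurrent [LocallyCompactSpace X] (hf : LipschitzWith 1 f) {w : X}
    (hrec : ∀ ε > 0, ∀ N : ℕ, ∃ n ≥ N, dist (f^[n] w) w < ε) : HasCompactOrbit f w := by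
  obtain ⟨r, hr, hU⟩ : ∃ r > 0, IsCompact (Metric.closedBall w r) := by
    obtain ⟨r, hr, h⟩ := (isCompact_singleton (x := w)).exists_isCompact_cthickening
    exact ⟨r, hr, by rwa [Metric.cthickening_singleton _ hr.le] at h⟩
  set U := Metric.closedBall w r
  set O : Set X := range fun n : ℕ => f^[n + 1] w
  obtain ⟨t, ht⟩ := (hU.inter_right (isClosed_closure (s := O))).elim_finite_subcover
    (fun n : ℕ => Metric.ball (f^[n + 1] w) r) (fun n => Metric.isOpen_ball) (by
      rintro y ⟨-, hy⟩
      obtain ⟨_, ⟨n, rfl⟩, hn⟩ := Metric.mem_closure_iff.1 hy r hr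
      exact mem_iUnion.2 ⟨n, hn⟩)
  set N := t.sup id + 1
  have key : ∀ m : ℕ, ∃ n ≤ N, f^[m + n] w ∈ U := by
    intro m
    have hex : ∃ n : ℕ, 1 ≤ n ∧ f^[m + n] w ∈ U := by
      obtain ⟨n, hn, hn'⟩ := hrec r hr (m + 1)
      refine ⟨n - m, by omega, ?_⟩
      rw [show m + (n - m) = n by omega]
      exact Metric.mem_closedBall.2 hn'.le
    classical
    -- the first return after time `m` comes at most `N` steps later
    set n := Nat.find hex
    obtain ⟨h1, h2⟩ := Nat.find_spec hex
    refine ⟨n, ?_, h2⟩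
    have h3 : f^[m + n] w ∈ U ∩ closure O :=
      ⟨h2, subset_closure ⟨m + n - 1, by
        show f^[m + n - 1 + 1] w = _
        rw [Nat.sub_add_cancel (le_trans h1 (Nat.le_add_left _ _))]⟩⟩
    obtain ⟨i, hi, h4⟩ := mem_iUnion₂.1 (ht h3)
    have hiN : i + 1 ≤ N := Nat.succ_le_succ (Finset.le_sup (f := id) hi)
    by_contra! hlt
    have h5 := dist_iterate_le_of_recurrent hf hrec (i + 1) (m + n - (i + 1))
    rw [show i + 1 + (m + n - (i + 1)) = m + n by omega] at h5
    refine Nat.find_min hex (m := n - (i + 1)) (by omega) ⟨by omega, ?_⟩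
    rw [show m + (n - (i + 1)) = m + n - (i + 1) by omega]
    exact Metric.mem_closedBall.2 (h5.trans (Metric.mem_ball.1 h4).le)
  refine ⟨⋃ j ∈ Finset.range (N + 1), f^[j] '' U,
    (Finset.range (N + 1)).isCompact_biUnion fun j _ =>
      hU.image (hf.iterate j).continuous, fun k => ?_⟩
  simp only [mem_iUnion, Finset.mem_range, exists_prop]
  by_cases hk : k < N
  · exact ⟨k, by omega, w, Metric.mem_closedBall_self hr.le, rfl⟩
  · obtain ⟨n, hn, hn'⟩ := key (k - N)
    refine ⟨N - n, by omega, _, hn', ?_⟩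
    rw [← Function.iterate_add_apply]
    congr 1
    omega

/-- **Całka's dichotomy**: an orbit of a nonexpanding map of a locally compact metric space with a
cluster point is relatively compact. -/
theorem hasCompactOrbit_of_mapClusterPt [LocallyCompactSpace X] (hf : LipschitzWith 1 f) {x w : X}
    (hw : MapClusterPt w atTop (fun n => f^[n] x)) : HasCompactOrbit f x := by
  obtain ⟨K, hK, hKw⟩ := hasCompactOrbit_of_recurrent hf
    fun ε hε N => exists_dist_iterate_lt_of_mapClusterPt hf hw hε N
  obtain ⟨δ, hδ, hKδ⟩ := hK.exists_isCompact_cthickening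
  obtain ⟨n, -, hn⟩ := (mapClusterPt_iff_frequently.1 hw _
    (Metric.ball_mem_nhds w hδ)).forall_exists_of_atTop 0
  refine ⟨Metric.cthickening δ K ∪ (fun i => f^[i] x) '' (Iio n),
    hKδ.union ((finite_Iio n).image _).isCompact, fun m => ?_⟩
  by_cases hm : m < n
  · exact Or.inr ⟨m, hm, rfl⟩
  · refine Or.inl (Metric.mem_cthickening_of_dist_le _ _ _ _ (hKw (m - n)) ?_)
    have h1 := dist_iterate_le hf (m - n) (f^[n] x) w
    rw [← Function.iterate_add_apply, Nat.sub_add_cancel (by omega)] at h1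
    exact h1.trans (Metric.mem_ball.1 hn).le

lemma hasCompactOrbit_or_orbitEscapes [LocallyCompactSpace X] (hf : LipschitzWith 1 f) (x : X) :
    HasCompactOrbit f x ∨ OrbitEscapes f x := by
  by_contra! h
  obtain ⟨h1, h2⟩ := h
  simp only [OrbitEscapes, not_forall] at h2
  obtain ⟨K, hK, h2⟩ := h2
  have h3 : ∃ᶠ n in atTop, f^[n] x ∈ K := by simpa [Filter.Frequently] using h2
  obtain ⟨w, -, hw⟩ := hK.exists_mapClusterPt_of_frequently h3
  exact h1 (hasCompactOrbit_of_mapClusterPt hf hw)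

lemma not_hasCompactOrbit_of_orbitEscapes {x : X} (h : OrbitEscapes f x) :
    ¬ HasCompactOrbit f x := by
  rintro ⟨K, hK, hx⟩
  obtain ⟨n, hn⟩ := (h K hK).exists
  exact hn (hx n)

lemma exists_pos_le_dist_of_orbitEscapes [LocallyCompactSpace X] (f : X → X) {K : Set X}
    (hK : IsCompact K) :
    ∃ δ > 0, ∀ x, OrbitEscapes f x → ∀ᶠ n in atTop, ∀ u ∈ K, δ ≤ dist (f^[n] x) u := by
  obtain ⟨δ, hδ, hKδ⟩ := hK.exists_isCompact_cthickening
  refine ⟨δ, hδ, fun x h => ?_⟩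
  filter_upwards [h _ hKδ] with n hn u hu
  by_contra! hlt
  exact hn (Metric.mem_cthickening_of_dist_le _ _ _ _ hu hlt.le)

/-- Escaping orbits of a nonexpanding map escape uniformly on compact sets. -/
lemma eventually_forall_notMem_of_orbitEscapes [LocallyCompactSpace X] (hf : LipschitzWith 1 f)
    (hesc : ∀ x, OrbitEscapes f x) {C K : Set X} (hC : IsCompact C) (hK : IsCompact K) :
    ∀ᶠ n in atTop, ∀ x ∈ C, f^[n] x ∉ K := by
  obtain ⟨δ, hδ, hsep⟩ := exists_pos_le_dist_of_orbitEscapes f hK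
  refine hC.induction_on (p := fun s => ∀ᶠ n in atTop, ∀ x ∈ s, f^[n] x ∉ K) (by simp)
    (fun s t hst ht => ht.mono fun n hn x hx => hn x (hst hx))
    (fun s t hs ht => (hs.and ht).mono fun n hn x hx => hx.elim (hn.1 x) (hn.2 x))
    (fun x _ => ⟨Metric.ball x δ, mem_nhdsWithin_of_mem_nhds (Metric.ball_mem_nhds x hδ), ?_⟩)
  filter_upwards [hsep x (hesc x)] with n hn y hy hyK
  have h1 := dist_iterate_le hf n x y
  rw [Metric.mem_ball, dist_comm] at hy
  linarith [hn _ hyK]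

end MetricDynamics

/-! ### Visible embeddings and the metric Denjoy–Wolff theorem -/

section MetricVisibility

variable {X E : Type*} [MetricSpace X] [MetricSpace E] {ι : X → E} {f : X → X}

/-- The metric space `X`, embedded in `E` by `ι`, is visible: points `x`, `y` near two distinct
boundary points always have a point `u` of a fixed compact set metrically between them. -/
def IsVisibleEmbedding (ι : X → E) : Prop :=
  ∀ p ∈ closure (range ι) \ range ι, ∀ q ∈ closure (range ι) \ range ι, p ≠ q →
    ∃ V ∈ 𝓝 p, ∃ W ∈ 𝓝 q, ∃ K : Set X, IsCompact K ∧
      ∀ x y, ι x ∈ V → ι y ∈ W → ∃ u ∈ K, dist x u + dist u y ≤ dist x y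

/-- The limits of the orbits in the boundary, along any ultrafilter, do not depend on the starting
point. -/
def HasCommonLimits (ι : X → E) (f : X → X) : Prop :=
  ∀ (𝒰 : Ultrafilter ℕ), (𝒰 : Filter ℕ) ≤ atTop → ∀ ξ ∈ closure (range ι) \ range ι, ∀ x y,
    Tendsto (fun n => ι (f^[n] x)) 𝒰 (𝓝 ξ) → Tendsto (fun n => ι (f^[n] y)) 𝒰 (𝓝 ξ)

lemma not_tendsto_ultrafilter_of_orbitEscapes [LocallyCompactSpace X] {x w : X}
    (h : OrbitEscapes f x) {𝒰 : Ultrafilter ℕ} (h𝒰 : (𝒰 : Filter ℕ) ≤ atTop) :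
    ¬ Tendsto (fun n => f^[n] x) 𝒰 (𝓝 w) := by
  intro hw
  obtain ⟨K, hK, hKw⟩ := exists_compact_mem_nhds w
  obtain ⟨n, h1, h2⟩ := ((hw.eventually_mem hKw).and (h𝒰 (h K hK))).exists
  exact h2 h1

/-- A sequence asymptotic to an escaping orbit converges, along an ultrafilter, to a boundary
point. -/
lemma exists_tendsto_boundary [LocallyCompactSpace X] (hι : IsEmbedding ι)
    (hc : IsCompact (closure (range ι))) {x : X} (h : OrbitEscapes f x) (y : ℕ → X)
    {𝒰 : Ultrafilter ℕ} (h𝒰 : (𝒰 : Filter ℕ) ≤ atTop)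
    (hy : Tendsto (fun n => dist (y n) (f^[n] x)) 𝒰 (𝓝 0)) :
    ∃ ξ ∈ closure (range ι) \ range ι, Tendsto (fun n => ι (y n)) 𝒰 (𝓝 ξ) := by
  obtain ⟨ξ, hξ, hlim⟩ := hc.ultrafilter_le_nhds (𝒰.map (fun n => ι (y n)))
    (tendsto_principal.2 (Eventually.of_forall fun n => subset_closure (mem_range_self (y n))))
  refine ⟨ξ, ⟨hξ, ?_⟩, hlim⟩
  rintro ⟨w, rfl⟩
  have h1 : Tendsto y 𝒰 (𝓝 w) := hι.tendsto_nhds_iff.2 hlim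
  exact not_tendsto_ultrafilter_of_orbitEscapes h h𝒰 (tendsto_of_tendsto_of_dist h1 hy)

/-- If the orbit of `o` accumulates at two distinct boundary points `ξ` and `η`, then it
accumulates at `η` only with unbounded distances: if the points of the orbit near `η` had distance
at most `r` from some point, then pushing that point along the orbit towards `ξ` would produce a
point, in the compact set of visibility, with the bound `r - δ` in place of `r`. -/
lemma not_eventually_dist_le [LocallyCompactSpace X]
    (hf : LipschitzWith 1 f) (hvis : IsVisibleEmbedding ι) (hlim : HasCommonLimits ι f)
    (hesc : ∀ x, OrbitEscapes f x) {o : X} {ξ η : E} (hξ : ξ ∈ closure (range ι) \ range ι)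
    (hη : η ∈ closure (range ι) \ range ι) (hne : ξ ≠ η)
    {𝒱 : Ultrafilter ℕ} (h𝒱 : (𝒱 : Filter ℕ) ≤ atTop)
    (hoξ : Tendsto (fun n => ι (f^[n] o)) 𝒱 (𝓝 ξ))
    {𝒰 : Ultrafilter ℕ} (h𝒰 : (𝒰 : Filter ℕ) ≤ atTop)
    (hoη : Tendsto (fun n => ι (f^[n] o)) 𝒰 (𝓝 η)) (x : X) (r : ℝ) :
    ¬ ∀ᶠ n in (𝒰 : Filter ℕ), dist x (f^[n] o) ≤ r := by
  obtain ⟨V, hV, W, hW, K, hK, hVW⟩ := hvis ξ hξ η hη hne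
  -- the distances `r` at which the orbit of `o` accumulates at `η`, as seen from some point
  let S : Set ℝ := {r | ∃ (x : X) (𝒰 : Ultrafilter ℕ), (𝒰 : Filter ℕ) ≤ atTop ∧
    Tendsto (fun n => ι (f^[n] o)) 𝒰 (𝓝 η) ∧ ∀ᶠ n in (𝒰 : Filter ℕ), dist x (f^[n] o) ≤ r}
  intro hr
  have hS : S.Nonempty := ⟨r, x, 𝒰, h𝒰, hoη, hr⟩
  have hSb : BddBelow S := by
    refine ⟨0, ?_⟩
    rintro r ⟨x, 𝒰, -, -, h⟩
    obtain ⟨n, hn⟩ := h.exists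
    exact dist_nonneg.trans hn
  clear hr hoη h𝒰 𝒰 x r
  obtain ⟨δ, hδ, hsep⟩ := exists_pos_le_dist_of_orbitEscapes f hK
  obtain ⟨r, ⟨x, 𝒰, h𝒰, hoη, hr⟩, hrS⟩ := Real.lt_sInf_add_pos hS (half_pos hδ)
  have hxξ := hlim 𝒱 h𝒱 ξ hξ o x hoξ
  obtain ⟨ν, hνV, hνK⟩ := ((hxξ.eventually_mem hV).and (h𝒱 (hsep x (hesc x)))).exists
  -- shifting the times by `ν` keeps the limit `η`, and replaces `x` by `f^[ν] x`
  have h1 : ∀ᶠ n in (𝒰 : Filter ℕ), ∃ u ∈ K, dist u (f^[n + ν] o) ≤ r - δ := by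
    have hoη' := hlim 𝒰 h𝒰 η hη o (f^[ν] o) hoη
    filter_upwards [hr, hoη'.eventually_mem hW] with n hn hnW
    obtain ⟨u, hu, hle⟩ := hVW _ _ hνV hnW
    rw [← Function.iterate_add_apply] at hle
    refine ⟨u, hu, ?_⟩
    have h2 := dist_iterate_le hf ν x (f^[n] o)
    rw [← Function.iterate_add_apply, add_comm ν n] at h2
    have := hνK u hu
    linarith
  obtain ⟨n₀, u₀, hu₀, -⟩ := h1.exists
  have : ∃ u : ℕ → X, (∀ n, u n ∈ K) ∧
      ∀ᶠ n in (𝒰 : Filter ℕ), dist (u n) (f^[n + ν] o) ≤ r - δ := by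
    classical
    refine ⟨fun n => if h : ∃ u ∈ K, dist u (f^[n + ν] o) ≤ r - δ then h.choose else u₀,
      fun n => ?_, ?_⟩
    · dsimp only
      split_ifs with h
      · exact h.choose_spec.1
      · exact hu₀
    · filter_upwards [h1] with n hn
      rw [dif_pos hn]
      exact hn.choose_spec.2
  obtain ⟨u, huK, hu⟩ := this
  obtain ⟨v, hvK, hv⟩ := hK.ultrafilter_le_nhds (𝒰.map u)
    (tendsto_principal.2 (Eventually.of_forall huK))
  have h3 : r - δ / 2 ∈ S := by
    refine ⟨v, 𝒰.map (· + ν), ?_, ?_, ?_⟩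
    · exact (Filter.map_mono h𝒰).trans (tendsto_add_atTop_nat ν)
    · show Tendsto _ (Filter.map _ _) _
      rw [tendsto_map'_iff]
      have := hlim 𝒰 h𝒰 η hη o (f^[ν] o) hoη
      simpa only [Function.comp_def, Function.iterate_add_apply] using this
    · show ∀ᶠ n in Filter.map _ _, _
      rw [eventually_map]
      have hv' : Tendsto u 𝒰 (𝓝 v) := hv
      filter_upwards [hu, hv'.eventually_mem (Metric.ball_mem_nhds v (half_pos hδ))] with n h4 h5
      have := dist_triangle v (u n) (f^[n + ν] o)
      rw [Metric.mem_ball, dist_comm] at h5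
      linarith
  have := csInf_le hSb h3
  linarith

/-- All limits of an orbit agree. Otherwise the distances from `o` to its orbit tend to infinity;
at the times of record distance the orbit has a limit `ξ`, and a different limit `η` contradicts
visibility, because a record distance bounds the distance between the two points of the orbit. -/
lemma orbit_limit_unique [LocallyCompactSpace X] (hι : IsEmbedding ι)
    (hc : IsCompact (closure (range ι)))
    (hf : LipschitzWith 1 f) (hvis : IsVisibleEmbedding ι) (hlim : HasCommonLimits ι f)
    (hesc : ∀ x, OrbitEscapes f x) {o : X} {ξ η : E} (hξ : ξ ∈ closure (range ι) \ range ι)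
    (hη : η ∈ closure (range ι) \ range ι)
    {𝒱 : Ultrafilter ℕ} (h𝒱 : (𝒱 : Filter ℕ) ≤ atTop)
    (hoξ : Tendsto (fun n => ι (f^[n] o)) 𝒱 (𝓝 ξ))
    {𝒰 : Ultrafilter ℕ} (h𝒰 : (𝒰 : Filter ℕ) ≤ atTop)
    (hoη : Tendsto (fun n => ι (f^[n] o)) 𝒰 (𝓝 η)) : ξ = η := by
  by_contra hne
  have hlim' : ∀ {𝒲 : Ultrafilter ℕ}, (𝒲 : Filter ℕ) ≤ atTop →
      ∃ ζ ∈ closure (range ι) \ range ι, Tendsto (fun n => ι (f^[n] o)) 𝒲 (𝓝 ζ) := by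
    intro 𝒲 h𝒲
    exact exists_tendsto_boundary hι hc (hesc o) (fun n => f^[n] o) h𝒲 (by simp)
  have hinf : Tendsto (fun n => dist o (f^[n] o)) atTop atTop := by
    rw [tendsto_atTop]
    intro r
    by_contra hcon
    have hfr : ∃ᶠ n in atTop, dist o (f^[n] o) ≤ r :=
      (Filter.not_eventually.1 hcon).mono fun n hn => (not_le.1 hn).le
    have : NeBot (atTop ⊓ 𝓟 {n : ℕ | dist o (f^[n] o) ≤ r}) := frequently_iff_neBot.1 hfr
    obtain ⟨𝒲, h𝒲⟩ := exists_ultrafilter_le (atTop ⊓ 𝓟 {n : ℕ | dist o (f^[n] o) ≤ r})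
    have h𝒲1 : (𝒲 : Filter ℕ) ≤ atTop := h𝒲.trans inf_le_left
    have h𝒲2 : ∀ᶠ n in (𝒲 : Filter ℕ), dist o (f^[n] o) ≤ r :=
      le_principal_iff.1 (h𝒲.trans inf_le_right)
    obtain ⟨ζ, hζ, hoζ⟩ := hlim' h𝒲1
    by_cases h : ξ = ζ
    · subst h
      exact not_eventually_dist_le hf hvis hlim hesc hη hζ (Ne.symm hne) h𝒰 hoη h𝒲1 hoζ o r h𝒲2
    · exact not_eventually_dist_le hf hvis hlim hesc hξ hζ h h𝒱 hoξ h𝒲1 hoζ o r h𝒲2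
  have hrec := frequently_high_scores hinf
  have : NeBot (atTop ⊓ 𝓟 {n : ℕ | ∀ k < n, dist o (f^[k] o) < dist o (f^[n] o)}) :=
    frequently_iff_neBot.1 hrec
  obtain ⟨𝒲, h𝒲⟩ := exists_ultrafilter_le
    (atTop ⊓ 𝓟 {n : ℕ | ∀ k < n, dist o (f^[k] o) < dist o (f^[n] o)})
  have h𝒲1 : (𝒲 : Filter ℕ) ≤ atTop := h𝒲.trans inf_le_left
  have h𝒲2 : ∀ᶠ n in (𝒲 : Filter ℕ), ∀ k < n, dist o (f^[k] o) < dist o (f^[n] o) :=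
    le_principal_iff.1 (h𝒲.trans inf_le_right)
  obtain ⟨ζ, hζ, hoζ⟩ := hlim' h𝒲1
  have key : ∀ {θ : E}, θ ∈ closure (range ι) \ range ι → ∀ {𝒰 : Ultrafilter ℕ},
      (𝒰 : Filter ℕ) ≤ atTop → Tendsto (fun n => ι (f^[n] o)) 𝒰 (𝓝 θ) → ζ = θ := by
    intro θ hθ 𝒰 h𝒰 hoθ
    by_contra hne
    obtain ⟨V, hV, W, hW, K, hK, hVW⟩ := hvis ζ hζ θ hθ hne
    obtain ⟨R, hR⟩ := hK.isBounded.subset_closedBall o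
    obtain ⟨m, hmW, hm⟩ := ((hoθ.eventually_mem hW).and
      (h𝒰 (hinf.eventually_gt_atTop (R + R)))).exists
    obtain ⟨n, ⟨hnV, hn⟩, hmn⟩ := (((hoζ.eventually_mem hV).and h𝒲2).and
      (h𝒲1 (eventually_gt_atTop m))).exists
    obtain ⟨u, hu, hle⟩ := hVW _ _ hnV hmW
    have hu' : dist u o ≤ R := Metric.mem_closedBall.1 (hR hu)
    have h1 : dist (f^[n] o) (f^[m] o) ≤ dist o (f^[n] o) := by
      have h2 := dist_iterate_le hf m (f^[n - m] o) o
      rw [← Function.iterate_add_apply, show m + (n - m) = n by omega] at h2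
      refine h2.trans ?_
      rw [dist_comm]
      by_cases hm0 : m = 0
      · subst hm0; exact le_rfl
      · exact (hn (n - m) (by omega)).le
    have h3 := dist_triangle o u (f^[n] o)
    have h4 := dist_triangle o u (f^[m] o)
    rw [dist_comm u (f^[n] o)] at h3
    rw [dist_comm o u] at h3 h4
    linarith
  exact hne ((key hξ h𝒱 hoξ).symm.trans (key hη h𝒰 hoη))

/-- If all orbits of a nonexpanding map escape, then they converge, locally uniformly, to one
boundary point. -/
theorem exists_tendstoUniformlyOn_of_orbitEscapes [LocallyCompactSpace X] [Nonempty X]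
    (hι : IsEmbedding ι) (hc : IsCompact (closure (range ι)))
    (hf : LipschitzWith 1 f) (hvis : IsVisibleEmbedding ι) (hlim : HasCommonLimits ι f)
    (hesc : ∀ x, OrbitEscapes f x) :
    ∃ ξ ∈ closure (range ι) \ range ι,
      (∀ x, Tendsto (fun n => ι (f^[n] x)) atTop (𝓝 ξ)) ∧
      ∀ K : Set X, IsCompact K →
        TendstoUniformlyOn (fun (n : ℕ) x => ι (f^[n] x)) (fun _ => ξ) atTop K := by
  obtain ⟨o⟩ := ‹Nonempty X›
  obtain ⟨𝒱, h𝒱⟩ := exists_ultrafilter_le (atTop : Filter ℕ)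
  obtain ⟨ξ, hξ, hoξ⟩ := exists_tendsto_boundary hι hc (hesc o) (fun n => f^[n] o) h𝒱 (by simp)
  have hconv : ∀ x, Tendsto (fun n => ι (f^[n] x)) atTop (𝓝 ξ) := by
    intro x
    rw [tendsto_iff_ultrafilter]
    intro 𝒰 h𝒰
    obtain ⟨η, hη, hoη⟩ := exists_tendsto_boundary hι hc (hesc o) (fun n => f^[n] o) h𝒰 (by simp)
    have := orbit_limit_unique hι hc hf hvis hlim hesc hξ hη h𝒱 hoξ h𝒰 hoη
    subst this
    exact hlim 𝒰 h𝒰 ξ hξ o x hoη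
  refine ⟨ξ, hξ, hconv, fun K hK => ?_⟩
  rw [Metric.tendstoUniformlyOn_iff]
  intro ε hε
  by_contra hcon
  have hfr : ∃ᶠ n in atTop, ∃ x ∈ K, ε ≤ dist ξ (ι (f^[n] x)) := by
    refine (Filter.not_eventually.1 hcon).mono fun n hn => ?_
    push Not at hn
    exact hn
  obtain ⟨_, x₀, hx₀, -⟩ := hfr.exists
  have : NeBot (atTop ⊓ 𝓟 {n : ℕ | ∃ x ∈ K, ε ≤ dist ξ (ι (f^[n] x))}) :=
    frequently_iff_neBot.1 hfr
  obtain ⟨𝒰, h𝒰⟩ := exists_ultrafilter_le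
    (atTop ⊓ 𝓟 {n : ℕ | ∃ x ∈ K, ε ≤ dist ξ (ι (f^[n] x))})
  have h𝒰1 : (𝒰 : Filter ℕ) ≤ atTop := h𝒰.trans inf_le_left
  have h𝒰2 : ∀ᶠ n in (𝒰 : Filter ℕ), ∃ x ∈ K, ε ≤ dist ξ (ι (f^[n] x)) :=
    le_principal_iff.1 (h𝒰.trans inf_le_right)
  have : ∃ z : ℕ → X, (∀ n, z n ∈ K) ∧
      ∀ᶠ n in (𝒰 : Filter ℕ), ε ≤ dist ξ (ι (f^[n] (z n))) := by
    classical
    refine ⟨fun n => if h : ∃ x ∈ K, ε ≤ dist ξ (ι (f^[n] x)) then h.choose else x₀,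
      fun n => ?_, ?_⟩
    · dsimp only
      split_ifs with h
      · exact h.choose_spec.1
      · exact hx₀
    · filter_upwards [h𝒰2] with n hn
      rw [dif_pos hn]
      exact hn.choose_spec.2
  obtain ⟨z, hzK, hz⟩ := this
  obtain ⟨w, hwK, hw⟩ := hK.ultrafilter_le_nhds (𝒰.map z)
    (tendsto_principal.2 (Eventually.of_forall hzK))
  have hw0 : Tendsto (fun n => dist (z n) w) 𝒰 (𝓝 0) :=
    tendsto_iff_dist_tendsto_zero.1 (show Tendsto z 𝒰 (𝓝 w) from hw)
  have hw1 : Tendsto (fun n => dist (f^[n] (z n)) (f^[n] w)) 𝒰 (𝓝 0) :=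
    squeeze_zero (fun _ => dist_nonneg) (fun n => dist_iterate_le hf n (z n) w) hw0
  obtain ⟨η, hη, hzη⟩ := exists_tendsto_boundary hι hc (hesc w) _ h𝒰1 hw1
  have hne : ξ ≠ η := by
    rintro rfl
    have h1 : Tendsto (fun n => dist ξ (ι (f^[n] (z n)))) 𝒰 (𝓝 0) := by
      simpa using (tendsto_const_nhds (x := ξ)).dist hzη
    have := ge_of_tendsto h1 hz
    linarith
  obtain ⟨V, hV, W, hW, H, hH, hVW⟩ := hvis ξ hξ η hη hne
  obtain ⟨δ, hδ, hsep⟩ := exists_pos_le_dist_of_orbitEscapes f hH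
  obtain ⟨n, ⟨⟨hn1, hn2⟩, hn3⟩, hn4⟩ := (((((hconv w).mono_left h𝒰1).eventually_mem hV).and
    (hzη.eventually_mem hW)).and (h𝒰1 (hsep w (hesc w)))).and (hw1.eventually_lt_const hδ) |>.exists
  obtain ⟨u, hu, hle⟩ := hVW _ _ hn1 hn2
  have h1 := hn3 u hu
  have h2 : 0 ≤ dist u (f^[n] (z n)) := dist_nonneg
  rw [dist_comm] at hn4
  linarith

end MetricVisibility

/-! ### The Hopf–Rinow theorem for locally compact length spaces -/

section LengthSpace

variable {X : Type*} [MetricSpace X]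

/-- Any two points are joined by curves of length arbitrarily close to their distance; the curves
are given with a 1-Lipschitz parametrization on `[0, ℓ]`. -/
def HasAlmostMinimalCurves (X : Type*) [MetricSpace X] : Prop :=
  ∀ x y : X, ∀ ℓ > dist x y, ∃ γ : ℝ → X, γ 0 = x ∧ γ ℓ = y ∧
    ∀ s ∈ Icc 0 ℓ, ∀ t ∈ Icc 0 ℓ, dist (γ s) (γ t) ≤ |s - t|

lemma HasAlmostMinimalCurves.exists_between (hX : HasAlmostMinimalCurves X) {x y : X} {a b : ℝ}
    (ha : 0 ≤ a) (hb : 0 ≤ b) (h : dist x y < a + b) : ∃ z, dist x z ≤ a ∧ dist z y ≤ b := by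
  obtain ⟨γ, rfl, rfl, hγ⟩ := hX x y (a + b) h
  refine ⟨γ a, ?_, ?_⟩
  · refine (hγ 0 ⟨le_rfl, by linarith⟩ a ⟨ha, by linarith⟩).trans ?_
    rw [zero_sub, abs_neg, abs_of_nonneg ha]
  · refine (hγ a ⟨ha, by linarith⟩ (a + b) ⟨by linarith, le_rfl⟩).trans ?_
    rw [sub_add_cancel_left, abs_neg, abs_of_nonneg hb]

/-- **Hopf–Rinow theorem**, first part: a complete locally compact length space is proper. The
radii of the compact closed balls about a point form a set that is open and closed. -/
theorem HasAlmostMinimalCurves.properSpace [LocallyCompactSpace X] [CompleteSpace X]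
    (hX : HasAlmostMinimalCurves X) : ProperSpace X := by
  refine ⟨fun x r₀ => ?_⟩
  by_contra hr₀
  set S : Set ℝ := {r | IsCompact (Metric.closedBall x r)}
  have hmono : ∀ {r s : ℝ}, r ≤ s → s ∈ S → r ∈ S := fun h hs =>
    IsCompact.of_isClosed_subset hs Metric.isClosed_closedBall
      (Metric.closedBall_subset_closedBall h)
  have h0 : (0 : ℝ) ∈ S := by simp [S]
  have hb : BddAbove S := ⟨r₀, fun r hr => by
    by_contra! h
    exact hr₀ (hmono h.le hr)⟩
  set R := sSup S
  have hR0 : 0 ≤ R := le_csSup hb h0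
  have hlt : ∀ r < R, r ∈ S := fun r hr => by
    obtain ⟨s, hs, hrs⟩ := exists_lt_of_lt_csSup ⟨0, h0⟩ hr
    exact hmono hrs.le hs
  have hRc : IsCompact (Metric.closedBall x R) := by
    refine TotallyBounded.isCompact_of_isClosed ?_ Metric.isClosed_closedBall
    rw [Metric.totallyBounded_iff]
    intro ε hε
    have hr : max (R - ε / 4) 0 ∈ S := by
      rcases max_choice (R - ε / 4) 0 with h | h <;> rw [h]
      · exact hlt _ (by linarith)
      · exact h0
    obtain ⟨t, ht, hcov⟩ := Metric.totallyBounded_iff.1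
      (show IsCompact (Metric.closedBall x (max (R - ε / 4) 0)) from hr).totallyBounded
      (ε / 2) (half_pos hε)
    refine ⟨t, ht, fun y hy => ?_⟩
    obtain ⟨z, hz1, hz2⟩ := hX.exists_between (x := x) (y := y) (a := max (R - ε / 4) 0)
      (b := 3 * ε / 8) (le_max_right _ _) (by positivity) (by
        have := le_max_left (R - ε / 4) 0
        rw [Metric.mem_closedBall, dist_comm] at hy
        linarith)
    obtain ⟨c, hc, hzc⟩ := mem_iUnion₂.1 (hcov (Metric.mem_closedBall'.2 hz1))
    refine mem_iUnion₂.2 ⟨c, hc, ?_⟩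
    rw [Metric.mem_ball] at hzc ⊢
    have := dist_triangle y z c
    rw [dist_comm y z] at this
    linarith
  obtain ⟨δ, hδ, hδc⟩ := hRc.exists_isCompact_cthickening
  have : R + δ / 2 ∈ S := by
    refine hδc.of_isClosed_subset Metric.isClosed_closedBall fun y hy => ?_
    obtain ⟨z, hz1, hz2⟩ := hX.exists_between (x := x) (y := y) (a := R) (b := δ)
      hR0 hδ.le (by
        rw [Metric.mem_closedBall, dist_comm] at hy
        linarith)
    refine Metric.mem_cthickening_of_dist_le _ z _ _ (Metric.mem_closedBall'.2 hz1) ?_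
    rwa [dist_comm]
  have := le_csSup hb this
  linarith

/-- **Hopf–Rinow theorem**, second part: in a proper length space, any two points are joined by a
geodesic, obtained as the limit along an ultrafilter of almost minimal curves. -/
theorem HasAlmostMinimalCurves.exists_geodesic [ProperSpace X]
    (hX : HasAlmostMinimalCurves X) (x y : X) :
    ∃ σ : ℝ → X, σ 0 = x ∧ σ (dist x y) = y ∧
      ∀ s ∈ Icc 0 (dist x y), ∀ t ∈ Icc 0 (dist x y), dist (σ s) (σ t) = |s - t| := by
  set L := dist x y
  have hpos : ∀ n : ℕ, (0 : ℝ) < 1 / (n + 1) := fun n => Nat.one_div_pos_of_nat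
  choose γ hγ0 hγ1 hγ using fun n : ℕ => hX x y (L + 1 / (n + 1)) (by have := hpos n; linarith)
  obtain ⟨𝒰, h𝒰⟩ := exists_ultrafilter_le (atTop : Filter ℕ)
  have hε : Tendsto (fun n : ℕ => (1 : ℝ) / (n + 1)) 𝒰 (𝓝 0) :=
    tendsto_one_div_add_atTop_nhds_zero_nat.mono_left h𝒰
  have hL : 0 ≤ L := dist_nonneg
  have hmem : ∀ {t}, t ∈ Icc 0 L → ∀ n : ℕ, t ∈ Icc 0 (L + 1 / (n + 1) : ℝ) :=
    fun ht n => ⟨ht.1, by have := hpos n; linarith [ht.2]⟩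
  have hend : ∀ n : ℕ, L + 1 / (n + 1) ∈ Icc 0 (L + 1 / (n + 1) : ℝ) :=
    fun n => ⟨by have := hpos n; linarith, le_rfl⟩
  have hex : ∀ t, ∃ p, t ∈ Icc 0 L → Tendsto (fun n => γ n t) 𝒰 (𝓝 p) := by
    intro t
    by_cases ht : t ∈ Icc 0 L
    · obtain ⟨p, -, hp⟩ := (isCompact_closedBall x L).ultrafilter_le_nhds
        (𝒰.map fun n => γ n t) (tendsto_principal.2 (Eventually.of_forall fun n => by
          have := hγ n t (hmem ht n) 0 (hmem ⟨le_rfl, hL⟩ n)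
          rw [hγ0, sub_zero, abs_of_nonneg ht.1] at this
          exact Metric.mem_closedBall.2 (this.trans ht.2)))
      exact ⟨p, fun _ => hp⟩
    · exact ⟨x, fun h => absurd h ht⟩
  choose σ hσ using hex
  have key : ∀ s ∈ Icc 0 L, ∀ t ∈ Icc 0 L, s ≤ t → dist (σ s) (σ t) = t - s := by
    intro s hs t ht hst
    refine tendsto_nhds_unique ((hσ s hs).dist (hσ t ht)) ?_
    have h1 : Tendsto (fun n : ℕ => t - s - 1 / ((n : ℝ) + 1)) 𝒰 (𝓝 (t - s)) := by
      simpa using (tendsto_const_nhds (x := t - s)).sub hε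
    refine tendsto_of_tendsto_of_tendsto_of_le_of_le h1 tendsto_const_nhds (fun n => ?_)
      (fun n => ?_)
    · have h2 := hγ n 0 (hmem ⟨le_rfl, hL⟩ n) s (hmem hs n)
      have h3 := hγ n t (hmem ht n) _ (hend n)
      rw [hγ0, zero_sub, abs_neg, abs_of_nonneg hs.1] at h2
      rw [hγ1, abs_sub_comm, abs_of_nonneg (by have := (hmem ht n).2; linarith)] at h3
      have := dist_triangle4 x (γ n s) (γ n t) y
      change t - s - 1 / ((n : ℝ) + 1) ≤ dist (γ n s) (γ n t)
      have hLd : L = dist x y := rfl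
      linarith
    · have := hγ n s (hmem hs n) t (hmem ht n)
      rwa [abs_sub_comm, abs_of_nonneg (by linarith)] at this
  refine ⟨σ, ?_, ?_, fun s hs t ht => ?_⟩
  · refine tendsto_nhds_unique (hσ 0 ⟨le_rfl, hL⟩) ?_
    simp only [hγ0]
    exact tendsto_const_nhds
  · refine tendsto_nhds_unique (hσ L ⟨hL, le_rfl⟩) ?_
    rw [tendsto_iff_dist_tendsto_zero]
    refine squeeze_zero (fun _ => dist_nonneg) (fun n => ?_) hε
    have h3 := hγ n L (hmem ⟨hL, le_rfl⟩ n) _ (hend n)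
    rwa [hγ1, sub_add_cancel_left, abs_neg, abs_of_pos (hpos n)] at h3
  · rcases le_total s t with h | h
    · rw [key s hs t ht h, abs_sub_comm, abs_of_nonneg (sub_nonneg.2 h)]
    · rw [dist_comm, key t ht s hs h, abs_of_nonneg (sub_nonneg.2 h)]

/-- In a proper space, limits of orbits of nonexpanding maps do not depend on the starting point:
near distinct limits, orbit points at bounded distance from each other would be at bounded distance
from a compact set. -/
lemma hasCommonLimits_of_properSpace [ProperSpace X] {E : Type*} [MetricSpace E] {ι : X → E}
    {f : X → X} (hι : IsEmbedding ι) (hc : IsCompact (closure (range ι))) (hf : LipschitzWith 1 f)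
    (hvis : IsVisibleEmbedding ι) (hesc : ∀ x, OrbitEscapes f x) : HasCommonLimits ι f := by
  intro 𝒰 h𝒰 ξ hξ x y hx
  obtain ⟨η, hη, hy⟩ := exists_tendsto_boundary hι hc (hesc y) (fun n => f^[n] y) h𝒰 (by simp)
  by_cases hne : ξ = η
  · rwa [hne]
  obtain ⟨V, hV, W, hW, K, hK, hVW⟩ := hvis ξ hξ η hη hne
  have hK' : IsCompact (Metric.cthickening (dist x y) K) := hK.cthickening
  obtain ⟨n, ⟨hn1, hn2⟩, hn3⟩ := (((hx.eventually_mem hV).and (hy.eventually_mem hW)).and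
    (h𝒰 (hesc x _ hK'))).exists
  obtain ⟨u, hu, hle⟩ := hVW _ _ hn1 hn2
  refine absurd (Metric.mem_cthickening_of_dist_le _ _ _ _ hu ?_) hn3
  have h1 := dist_iterate_le hf n x y
  have h2 : 0 ≤ dist u (f^[n] y) := dist_nonneg
  linarith

/-- In a proper space, one bounded orbit of a nonexpanding map forces all orbits to be bounded. -/
lemma HasCompactOrbit.of_properSpace [ProperSpace X] {f : X → X} (hf : LipschitzWith 1 f) {x : X}
    (h : HasCompactOrbit f x) (y : X) : HasCompactOrbit f y := by
  obtain ⟨K, hK, hx⟩ := h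
  refine ⟨Metric.cthickening (dist y x) K, hK.cthickening, fun n => ?_⟩
  exact Metric.mem_cthickening_of_dist_le _ _ _ _ (hx n) (dist_iterate_le hf n y x)

end LengthSpace

/-! ### The Poincaré distance and discs in normal form -/

section Poincare

lemma one_add_conj_mul_ne_zero {a z : ℂ} (ha : a ∈ Metric.ball (0 : ℂ) 1)
    (hz : z ∈ Metric.ball (0 : ℂ) 1) : 1 + (starRingEnd ℂ) a * z ≠ 0 := by
  intro h
  rw [mem_ball_zero_iff] at ha hz
  have h1 : ‖(starRingEnd ℂ) a * z‖ = 1 := by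
    rw [eq_neg_of_add_eq_zero_right h, norm_neg, norm_one]
  rw [norm_mul, RCLike.norm_conj] at h1
  nlinarith [norm_nonneg a, norm_nonneg z]

/-- The automorphism of the unit disc that takes `0` to `a`, with positive derivative there. -/
noncomputable def discAut (a z : ℂ) : ℂ := (z + a) / (1 + (starRingEnd ℂ) a * z)

lemma discAut_mem_ball {a z : ℂ} (ha : a ∈ Metric.ball (0 : ℂ) 1)
    (hz : z ∈ Metric.ball (0 : ℂ) 1) : discAut a z ∈ Metric.ball (0 : ℂ) 1 := by
  have hne := one_add_conj_mul_ne_zero ha hz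
  rw [mem_ball_zero_iff] at ha hz ⊢
  rw [discAut, norm_div, div_lt_one (norm_pos_iff.2 hne)]
  refine lt_of_pow_lt_pow_left₀ 2 (norm_nonneg _) ?_
  have ha' : ‖a‖ ^ 2 < 1 := by nlinarith [norm_nonneg a]
  have hz' : ‖z‖ ^ 2 < 1 := by nlinarith [norm_nonneg z]
  rw [← Complex.normSq_eq_norm_sq, Complex.normSq_apply] at ha' hz' ⊢
  rw [← Complex.normSq_eq_norm_sq, Complex.normSq_apply]
  simp only [Complex.add_re, Complex.add_im, Complex.one_re, Complex.one_im, Complex.mul_re,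
    Complex.mul_im, Complex.conj_re, Complex.conj_im]
  nlinarith [mul_pos (sub_pos.2 ha') (sub_pos.2 hz')]

lemma differentiableOn_discAut {a : ℂ} (ha : a ∈ Metric.ball (0 : ℂ) 1) :
    DifferentiableOn ℂ (discAut a) (Metric.ball 0 1) := by
  intro z hz
  have hne := one_add_conj_mul_ne_zero ha hz
  refine DifferentiableAt.differentiableWithinAt ?_
  unfold discAut
  fun_prop (disch := exact hne)

lemma discAut_zero (a : ℂ) : discAut a 0 = a := by simp [discAut]

lemma discAut_div {a b : ℂ} (ha : a ∈ Metric.ball (0 : ℂ) 1) (hb : b ∈ Metric.ball (0 : ℂ) 1) :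
    discAut a ((b - a) / (1 - (starRingEnd ℂ) a * b)) = b := by
  have h1 : 1 - (starRingEnd ℂ) a * b ≠ 0 := by
    have := one_add_conj_mul_ne_zero (a := -a) (by simpa using ha) hb
    simpa [sub_eq_add_neg] using this
  have h2 : 1 - (starRingEnd ℂ) a * a ≠ 0 := by
    have := one_add_conj_mul_ne_zero (a := -a) (by simpa using ha) ha
    simpa [sub_eq_add_neg] using this
  rw [discAut, div_add' _ _ _ h1, mul_div_assoc', one_add_div h1, div_div_div_cancel_right₀ h1,
    div_eq_iff]
  · ring
  · intro h
    apply h2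
    rw [← h]
    ring

lemma hasDerivAt_discAut_zero (a : ℂ) :
    HasDerivAt (discAut a) (1 - (starRingEnd ℂ) a * a) 0 := by
  have h : HasDerivAt (discAut a) _ 0 := ((hasDerivAt_id (0 : ℂ)).add_const a).div
    (((hasDerivAt_id (0 : ℂ)).const_mul ((starRingEnd ℂ) a)).const_add 1) (by simp)
  refine h.congr_deriv ?_
  simp
  ring

lemma ofReal_tanh_mem_ball (t : ℝ) : (Real.tanh t : ℂ) ∈ Metric.ball (0 : ℂ) 1 := by
  rw [mem_ball_zero_iff, Complex.norm_real]
  exact Real.abs_tanh_lt_one t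

lemma tanh_nonneg {t : ℝ} (ht : 0 ≤ t) : 0 ≤ Real.tanh t := by
  rw [Real.tanh_eq_sinh_div_cosh]
  exact div_nonneg (Real.sinh_nonneg_iff.2 ht) (Real.cosh_pos t).le

lemma hasDerivAt_tanh (t : ℝ) : HasDerivAt Real.tanh (1 - Real.tanh t ^ 2) t := by
  have h := (Real.hasDerivAt_sinh t).div (Real.hasDerivAt_cosh t) (Real.cosh_pos t).ne'
  have he : Real.tanh = Real.sinh / Real.cosh := funext Real.tanh_eq_sinh_div_cosh
  rw [he]
  refine h.congr_deriv ?_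
  have := (Real.cosh_pos t).ne'
  simp only [Pi.div_apply]
  field_simp

lemma tanh_le_self {t : ℝ} (ht : 0 ≤ t) : Real.tanh t ≤ t := by
  have h : ∀ x, HasDerivAt (fun x => x - Real.tanh x) (Real.tanh x ^ 2) x := fun x =>
    ((hasDerivAt_id' x).sub (hasDerivAt_tanh x)).congr_deriv (by ring)
  have hmono : Monotone fun x => x - Real.tanh x :=
    monotone_of_deriv_nonneg (fun x => (h x).differentiableAt) fun x => by
      rw [(h x).deriv]
      positivity
  have := hmono ht
  simp only [Real.tanh_zero, sub_zero] at this
  linarith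

lemma tanh_sub_div (s t : ℝ) :
    (Real.tanh s - Real.tanh t) / (1 - Real.tanh t * Real.tanh s) = Real.tanh (s - t) := by
  have hs := (Real.cosh_pos s).ne'
  have ht := (Real.cosh_pos t).ne'
  have hst := (Real.cosh_pos (s - t)).ne'
  rw [Real.cosh_sub] at hst
  simp only [Real.tanh_eq_sinh_div_cosh, Real.sinh_sub, Real.cosh_sub]
  have h1 : 1 - Real.sinh t / Real.cosh t * (Real.sinh s / Real.cosh s) =
      (Real.cosh s * Real.cosh t - Real.sinh s * Real.sinh t) / (Real.cosh s * Real.cosh t) := by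
    field_simp
  have h2 : Real.sinh s / Real.cosh s - Real.sinh t / Real.cosh t =
      (Real.sinh s * Real.cosh t - Real.cosh s * Real.sinh t) / (Real.cosh s * Real.cosh t) := by
    field_simp
  rw [h1, h2, div_div_div_cancel_right₀ (mul_ne_zero hs ht)]

lemma poincareDist_tanh (s t : ℝ) : poincareDist (Real.tanh s) (Real.tanh t) = |s - t| := by
  have h : ((Real.tanh s : ℂ) - Real.tanh t) /
      (1 - (starRingEnd ℂ) (Real.tanh t : ℂ) * Real.tanh s) = (Real.tanh (s - t) : ℝ) := by
    rw [Complex.conj_ofReal, ← tanh_sub_div]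
    push_cast
    rfl
  rw [poincareDist, h, Complex.norm_real, Real.norm_eq_abs]
  rcases le_total 0 (s - t) with hst | hst
  · rw [abs_of_nonneg hst, abs_of_nonneg (tanh_nonneg hst), Real.artanh_tanh]
  · have h2 : Real.tanh (s - t) = -Real.tanh (-(s - t)) := by rw [Real.tanh_neg, neg_neg]
    rw [abs_of_nonpos hst, h2, abs_neg, abs_of_nonneg (tanh_nonneg (neg_nonneg.2 hst)),
      Real.artanh_tanh]

lemma poincareDist_nonneg (a b : ℂ) : 0 ≤ poincareDist a b := Real.artanh_nonneg (norm_nonneg _)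

variable {d : ℕ} {M : Set (EuclideanSpace ℂ (Fin d))} {f : ℂ → EuclideanSpace ℂ (Fin d)}

lemma IsHolomorphicDisc.comp (hf : IsHolomorphicDisc M f) {h : ℂ → ℂ}
    (hd : DifferentiableOn ℂ h (Metric.ball 0 1))
    (hm : MapsTo h (Metric.ball 0 1) (Metric.ball 0 1)) : IsHolomorphicDisc M (f ∘ h) :=
  ⟨hf.1.comp hd hm, hf.2.comp hm⟩

/-- A disc through two points can be reparametrized by an automorphism of the unit disc, so that
the points are the images of `0` and of a point of `[0, 1)`. -/
lemma IsHolomorphicDisc.exists_normalForm (hf : IsHolomorphicDisc M f) {a b : ℂ}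
    (ha : a ∈ Metric.ball (0 : ℂ) 1) (hb : b ∈ Metric.ball (0 : ℂ) 1) :
    ∃ g, IsHolomorphicDisc M g ∧ g 0 = f a ∧ g (Real.tanh (poincareDist a b)) = f b := by
  set w : ℂ := (b - a) / (1 - (starRingEnd ℂ) a * b) with hw
  have hw1 : ‖(a - b) / (1 - (starRingEnd ℂ) b * a)‖ = ‖w‖ := by
    rw [hw, norm_div, norm_div, norm_sub_rev, ← RCLike.norm_conj (1 - (starRingEnd ℂ) b * a)]
    simp [mul_comm]
  have hwb : ‖w‖ < 1 := by
    have h1 := discAut_mem_ball (a := -a) (z := b) (by simpa using ha) hb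
    rw [mem_ball_zero_iff] at h1
    simpa [discAut, hw, sub_eq_add_neg] using h1
  have htanh : Real.tanh (poincareDist a b) = ‖w‖ := by
    rw [poincareDist, hw1, Real.tanh_artanh ⟨by linarith [norm_nonneg w], hwb⟩]
  set c : ℂ := Complex.exp (Complex.arg w * Complex.I)
  have hc : ‖c‖ = 1 := Complex.norm_exp_ofReal_mul_I _
  have hcm : MapsTo (fun z => c * z) (Metric.ball (0 : ℂ) 1) (Metric.ball 0 1) := by
    intro z hz
    rw [mem_ball_zero_iff] at hz ⊢
    simpa [hc] using hz
  refine ⟨f ∘ discAut a ∘ fun z => c * z, hf.comp ((differentiableOn_discAut ha).comp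
    (by fun_prop) hcm) (MapsTo.comp (fun z hz => discAut_mem_ball ha hz) hcm), ?_, ?_⟩
  · simp [discAut_zero]
  · have : c * (‖w‖ : ℂ) = w := by
      rw [mul_comm]
      exact Complex.norm_mul_exp_arg_mul_I w
    rw [Function.comp_apply, Function.comp_apply, htanh, this, hw, discAut_div ha hb]

/-- The hyperbolic geodesic `t ↦ tanh t` in a disc has at most unit speed for the Kobayashi–Royden
metric. -/
lemma IsHolomorphicDisc.kobayashiRoyden_tanh_le (hf : IsHolomorphicDisc M f) (t : ℝ) :
    kobayashiRoyden M (f (Real.tanh t)) (deriv (fun s : ℝ => f (Real.tanh s)) t) ≤ 1 := by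
  set r : ℂ := (Real.tanh t : ℂ) with hr
  have hrb : r ∈ Metric.ball (0 : ℂ) 1 := ofReal_tanh_mem_ball t
  have hfd : HasDerivAt f (deriv f r) r :=
    (hf.1.differentiableAt (Metric.isOpen_ball.mem_nhds hrb)).hasDerivAt
  -- recentring the disc at `r` gives a competitor whose derivative at `0` is the velocity
  refine sInf_le ⟨1, f ∘ discAut r, one_pos, hf.comp (differentiableOn_discAut hrb)
    (fun z hz => discAut_mem_ball hrb hz), by simp [discAut_zero], ?_, by simp⟩
  have h1 : HasDerivAt (f ∘ discAut r) ((1 - (starRingEnd ℂ) r * r) • deriv f r) 0 :=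
    HasDerivAt.scomp 0 (by rwa [discAut_zero]) (hasDerivAt_discAut_zero r)
  have h2 : HasDerivAt (fun s : ℝ => f (Real.tanh s))
      (((1 - Real.tanh t ^ 2 : ℝ) : ℂ) • deriv f r) t :=
    HasDerivAt.scomp t hfd (hasDerivAt_tanh t).ofReal_comp
  rw [h1.deriv, h2.deriv, Complex.ofReal_one, one_smul, hr, Complex.conj_ofReal]
  congr 1
  push_cast
  ring

end Poincare

variable {d : ℕ}

/-! ### Chains of discs and the Kobayashi metric -/

/-- `DiscChain M z w ℓ`: a chain of discs in `M` of total Poincaré length `ℓ` leads from `z` to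
`w`. Every disc is in normal form, linking `g 0` to `g (tanh ℓ)` with Poincaré length `ℓ`. -/
inductive DiscChain (M : Set (EuclideanSpace ℂ (Fin d))) :
    EuclideanSpace ℂ (Fin d) → EuclideanSpace ℂ (Fin d) → ℝ → Prop
  | nil (z : EuclideanSpace ℂ (Fin d)) : DiscChain M z z 0
  | cons {g : ℂ → EuclideanSpace ℂ (Fin d)} {ℓ L : ℝ} {w : EuclideanSpace ℂ (Fin d)}
      (hg : IsHolomorphicDisc M g) (hℓ : 0 ≤ ℓ) (h : DiscChain M (g (Real.tanh ℓ)) w L) :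
      DiscChain M (g 0) w (ℓ + L)

section Chain

variable {M : Set (EuclideanSpace ℂ (Fin d))} {z w v : EuclideanSpace ℂ (Fin d)} {ℓ L : ℝ}

lemma DiscChain.of_disc {f : ℂ → EuclideanSpace ℂ (Fin d)} (hf : IsHolomorphicDisc M f) {a b : ℂ}
    (ha : a ∈ Metric.ball (0 : ℂ) 1) (hb : b ∈ Metric.ball (0 : ℂ) 1) :
    DiscChain M (f a) (f b) (poincareDist a b) := by
  obtain ⟨g, hg, h0, h1⟩ := hf.exists_normalForm ha hb
  have := DiscChain.cons hg (poincareDist_nonneg a b) (DiscChain.nil _)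
  rwa [h0, h1, add_zero] at this

lemma DiscChain.of_tanh {f : ℂ → EuclideanSpace ℂ (Fin d)} (hf : IsHolomorphicDisc M f) {s t : ℝ}
    (hst : s ≤ t) : DiscChain M (f (Real.tanh s)) (f (Real.tanh t)) (t - s) := by
  have h := DiscChain.of_disc hf (ofReal_tanh_mem_ball s) (ofReal_tanh_mem_ball t)
  rwa [poincareDist_tanh, abs_sub_comm, abs_of_nonneg (sub_nonneg.2 hst)] at h

lemma DiscChain.nonneg (h : DiscChain M z w ℓ) : 0 ≤ ℓ := by
  induction h with
  | nil z => exact le_rfl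
  | cons hg hℓ h ih => exact add_nonneg hℓ ih

lemma DiscChain.trans (h : DiscChain M z w ℓ) (h' : DiscChain M w v L) :
    DiscChain M z v (ℓ + L) := by
  induction h with
  | nil z => rwa [zero_add]
  | cons hg hℓ h ih =>
    rw [add_assoc]
    exact DiscChain.cons hg hℓ (ih h')

lemma DiscChain.symm (h : DiscChain M z w ℓ) : DiscChain M w z ℓ := by
  induction h with
  | nil z => exact DiscChain.nil z
  | @cons g ℓ L w hg hℓ h ih =>
    have h1 := DiscChain.of_disc hg (ofReal_tanh_mem_ball ℓ) (ofReal_tanh_mem_ball 0)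
    rw [poincareDist_tanh, sub_zero, abs_of_nonneg hℓ, Real.tanh_zero, Complex.ofReal_zero] at h1
    rw [add_comm]
    exact ih.trans h1

/-- Holomorphic maps do not increase the length of chains. -/
lemma DiscChain.map {Φ : EuclideanSpace ℂ (Fin d) → EuclideanSpace ℂ (Fin d)}
    (hΦ : ∀ f, IsHolomorphicDisc M f → IsHolomorphicDisc M (Φ ∘ f)) (h : DiscChain M z w ℓ) :
    DiscChain M (Φ z) (Φ w) ℓ := by
  induction h with
  | nil z => exact DiscChain.nil _
  | cons hg hℓ h ih => exact DiscChain.cons (hΦ _ hg) hℓ ih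

/-- The Schwarz lemma bounds Euclidean distances in a bounded set by lengths of chains. -/
lemma DiscChain.dist_le {R : ℝ} (hR : M ⊆ Metric.closedBall 0 R) (h : DiscChain M z w ℓ) :
    dist z w ≤ 2 * R * ℓ := by
  induction h with
  | nil z => simp
  | @cons g ℓ L w hg hℓ h ih =>
    have h0 : g 0 ∈ Metric.closedBall 0 R := hR (hg.2 (Metric.mem_ball_self one_pos))
    have hR0 : 0 ≤ R := by
      rw [mem_closedBall_zero_iff] at h0
      exact (norm_nonneg _).trans h0
    have hmaps : MapsTo g (Metric.ball 0 1) (Metric.closedBall (g 0) (2 * R)) := by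
      intro ζ hζ
      have h1 := hR (hg.2 hζ)
      rw [Metric.mem_closedBall] at h0 h1 ⊢
      have := dist_triangle_right (g ζ) (g 0) 0
      linarith
    have h1 := Complex.dist_le_div_mul_dist_of_mapsTo_ball hg.1 hmaps (ofReal_tanh_mem_ball ℓ)
    have h2 : dist ((Real.tanh ℓ : ℝ) : ℂ) 0 ≤ ℓ := by
      rw [dist_zero_right, Complex.norm_real, Real.norm_eq_abs, abs_of_nonneg (tanh_nonneg hℓ)]
      exact tanh_le_self hℓ
    rw [div_one] at h1
    have h5 := mul_le_mul_of_nonneg_left h2 (by positivity : 0 ≤ 2 * R)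
    have h6 := dist_triangle (g 0) (g (Real.tanh ℓ)) w
    rw [dist_comm (g 0) (g (Real.tanh ℓ))] at h6
    linarith

lemma setOf_chain_eq (M : Set (EuclideanSpace ℂ (Fin d))) (z w : EuclideanSpace ℂ (Fin d)) :
    {ℓ : ℝ | ∃ (m : ℕ) (x : ℕ → EuclideanSpace ℂ (Fin d))
      (f : ℕ → ℂ → EuclideanSpace ℂ (Fin d)) (a b : ℕ → ℂ),
      x 0 = z ∧ x m = w ∧
      (∀ i < m, IsHolomorphicDisc M (f i) ∧
        a i ∈ Metric.ball (0 : ℂ) 1 ∧ b i ∈ Metric.ball (0 : ℂ) 1 ∧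
        f i (a i) = x i ∧ f i (b i) = x (i + 1)) ∧
      ℓ = ∑ i ∈ Finset.range m, poincareDist (a i) (b i)} = {ℓ | DiscChain M z w ℓ} := by
  ext ℓ
  constructor
  · rintro ⟨m, x, f, a, b, rfl, rfl, h, rfl⟩
    induction m with
    | zero => simpa using DiscChain.nil (x 0)
    | succ m ih =>
      obtain ⟨hf, ha, hb, h1, h2⟩ := h m (Nat.lt_succ_self m)
      have h3 := DiscChain.of_disc hf ha hb
      rw [h1, h2] at h3
      rw [Finset.sum_range_succ]
      exact (ih fun i hi => h i (hi.trans (Nat.lt_succ_self m))).trans h3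
  · intro h
    induction h with
    | nil z =>
      exact ⟨0, fun _ => z, fun _ _ => z, fun _ => 0, fun _ => 0, rfl, rfl, by simp, by simp⟩
    | @cons g ℓ L w hg hℓ h ih =>
      obtain ⟨m, x, f, a, b, hx0, hxm, h', hL⟩ := ih
      refine ⟨m + 1, fun i => Nat.casesOn i (g 0) x, fun i => Nat.casesOn i g f,
        fun i => Nat.casesOn i 0 a, fun i => Nat.casesOn i (Real.tanh ℓ : ℂ) b, rfl, hxm, ?_, ?_⟩
      · rintro (_ | i) hi
        · exact ⟨hg, Metric.mem_ball_self one_pos, ofReal_tanh_mem_ball ℓ, rfl, hx0.symm⟩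
        · exact h' i (by omega)
      · have h1 := poincareDist_tanh 0 ℓ
        rw [zero_sub, abs_neg, abs_of_nonneg hℓ, Real.tanh_zero, Complex.ofReal_zero] at h1
        rw [Finset.sum_range_succ', add_comm, hL]
        congr 1
        exact h1.symm

lemma kobayashiDist_eq (M : Set (EuclideanSpace ℂ (Fin d))) (z w : EuclideanSpace ℂ (Fin d)) :
    kobayashiDist M z w = sInf {ℓ | DiscChain M z w ℓ} := by
  rw [kobayashiDist, setOf_chain_eq]

lemma DiscChain.bddBelow (M : Set (EuclideanSpace ℂ (Fin d))) (z w : EuclideanSpace ℂ (Fin d)) :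
    BddBelow {ℓ | DiscChain M z w ℓ} := ⟨0, fun _ h => h.nonneg⟩

lemma DiscChain.kobayashiDist_le (h : DiscChain M z w ℓ) : kobayashiDist M z w ≤ ℓ := by
  rw [kobayashiDist_eq]
  exact csInf_le (DiscChain.bddBelow M z w) h

/-- Nearby points of a submanifold lie on a common disc: a complex line segment in a chart. -/
lemma IsEmbeddedComplexSubmanifold.eventually_discChain (hM : IsEmbeddedComplexSubmanifold M)
    {p : EuclideanSpace ℂ (Fin d)} (hp : p ∈ M) {ε : ℝ} (hε : 0 < ε) :
    ∀ᶠ z in 𝓝[M] p, ∃ ℓ < ε, DiscChain M p z ℓ := by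
  obtain ⟨n, h⟩ := hM
  obtain ⟨φ, L, -, hps, hφ, hφs, hML⟩ := h p hp
  obtain ⟨r, hr, hball⟩ := Metric.isOpen_iff.1 φ.open_target (φ p) (φ.map_source hps)
  have hδ : 0 < r * Real.tanh (ε / 2) := by
    refine mul_pos hr (lt_of_le_of_ne (tanh_nonneg (by positivity)) fun h => ?_)
    rw [← Real.tanh_zero] at h
    have := Real.tanh_injective h
    linarith
  have hcont : ContinuousAt φ p := φ.continuousAt hps
  have hL : ∀ z, z ∈ M → z ∈ φ.source → φ z ∈ L := fun z hz hzs => (hML z hzs).1 hz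
  filter_upwards [self_mem_nhdsWithin, mem_nhdsWithin_of_mem_nhds (φ.open_source.mem_nhds hps),
    mem_nhdsWithin_of_mem_nhds (hcont.preimage_mem_nhds (Metric.ball_mem_nhds (φ p) hδ))]
    with z hzM hzs hz
  rw [mem_preimage, Metric.mem_ball, dist_eq_norm] at hz
  set v := φ z - φ p
  have hvL : v ∈ L := L.sub_mem (hL z hzM hzs) (hL p hp hps)
  set t := ‖v‖ / r
  have ht0 : 0 ≤ t := by positivity
  have ht1 : t < Real.tanh (ε / 2) := by rwa [div_lt_iff₀' hr]
  have ht1' : t < 1 := ht1.trans (Real.tanh_lt_one _)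
  -- the affine disc of radius `r` in the chart, in the direction of `z`
  set c : EuclideanSpace ℂ (Fin d) := ((t : ℂ)⁻¹) • v
  have htc : (t : ℂ) • c = v := by
    by_cases h0 : t = 0
    · have hv : v = 0 := by
        rcases div_eq_zero_iff.1 h0 with h | h
        · exact norm_eq_zero.1 h
        · exact absurd h hr.ne'
      rw [h0, hv, Complex.ofReal_zero, zero_smul]
    · exact smul_inv_smul₀ (Complex.ofReal_ne_zero.2 h0) v
  have hc : ‖c‖ ≤ r := by
    rw [norm_smul, norm_inv, Complex.norm_real, Real.norm_of_nonneg ht0]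
    by_cases h0 : ‖v‖ = 0
    · rw [h0, mul_zero]; exact hr.le
    · have : (‖v‖ / r)⁻¹ * ‖v‖ = r := by field_simp
      exact this.le
  have hmem : ∀ ζ ∈ Metric.ball (0 : ℂ) 1, φ p + ζ • c ∈ φ.target := by
    intro ζ hζ
    apply hball
    rw [mem_ball_zero_iff] at hζ
    rw [mem_ball_iff_norm, add_sub_cancel_left, norm_smul]
    nlinarith [norm_nonneg c, norm_nonneg ζ]
  have hdisc : IsHolomorphicDisc M fun ζ => φ.symm (φ p + ζ • c) := by
    constructor
    · exact hφs.comp (f := fun ζ : ℂ => φ p + ζ • c) (by fun_prop) hmem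
    · intro ζ hζ
      refine (hML _ (φ.map_target (hmem ζ hζ))).2 ?_
      rw [φ.right_inv (hmem ζ hζ)]
      exact L.add_mem (hL p hp hps) (L.smul_mem _ (L.smul_mem _ hvL))
  have htanh : Real.tanh (Real.artanh t) = t := Real.tanh_artanh ⟨by linarith, ht1'⟩
  refine ⟨Real.artanh t, ?_, ?_⟩
  · have := Real.artanh_lt_artanh (by linarith) (Real.tanh_lt_one _) ht1
    rw [Real.artanh_tanh] at this
    linarith
  · have h1 := DiscChain.of_tanh hdisc (Real.artanh_nonneg ht0)
    rw [sub_zero, Real.tanh_zero, htanh] at h1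
    simp only [Complex.ofReal_zero, zero_smul, add_zero, htc] at h1
    rwa [φ.left_inv hps, add_sub_cancel, φ.left_inv hzs] at h1

lemma IsEmbeddedComplexSubmanifold.exists_discChain (hM : IsEmbeddedComplexSubmanifold M)
    (hconn : IsConnected M) (hz : z ∈ M) (hw : w ∈ M) : ∃ ℓ, DiscChain M z w ℓ := by
  refine hconn.isPreconnected.induction₂' (fun z w => ∃ ℓ, DiscChain M z w ℓ) (fun p hp => ?_)
    ?_ hz hw
  · filter_upwards [hM.eventually_discChain hp one_pos] with z hz
    obtain ⟨ℓ, -, h⟩ := hz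
    exact ⟨⟨ℓ, h⟩, ⟨ℓ, h.symm⟩⟩
  · rintro x y z - - - ⟨ℓ, h⟩ ⟨L, h'⟩
    exact ⟨_, h.trans h'⟩

lemma exists_discChain_lt (hM : IsEmbeddedComplexSubmanifold M) (hconn : IsConnected M)
    (hz : z ∈ M) (hw : w ∈ M) {r : ℝ} (hr : kobayashiDist M z w < r) :
    ∃ ℓ < r, DiscChain M z w ℓ := by
  rw [kobayashiDist_eq] at hr
  obtain ⟨ℓ, h, hlt⟩ := exists_lt_of_csInf_lt (hM.exists_discChain hconn hz hw) hr
  exact ⟨ℓ, hlt, h⟩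

lemma kobayashiDist_nonneg (M : Set (EuclideanSpace ℂ (Fin d))) (z w : EuclideanSpace ℂ (Fin d)) :
    0 ≤ kobayashiDist M z w := by
  rw [kobayashiDist_eq]
  exact Real.sInf_nonneg fun _ h => h.nonneg

lemma kobayashiDist_comm (M : Set (EuclideanSpace ℂ (Fin d))) (z w : EuclideanSpace ℂ (Fin d)) :
    kobayashiDist M z w = kobayashiDist M w z := by
  rw [kobayashiDist_eq, kobayashiDist_eq]
  congr 1
  ext ℓ
  exact ⟨DiscChain.symm, DiscChain.symm⟩

lemma dist_le_kobayashiDist (hM : IsEmbeddedComplexSubmanifold M) (hconn : IsConnected M)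
    {R : ℝ} (hR0 : 0 < R) (hR : M ⊆ Metric.closedBall 0 R) (hz : z ∈ M) (hw : w ∈ M) :
    dist z w ≤ 2 * R * kobayashiDist M z w := by
  rw [← div_le_iff₀' (by positivity), kobayashiDist_eq]
  refine le_csInf (hM.exists_discChain hconn hz hw) fun ℓ h => ?_
  rw [div_le_iff₀' (by positivity)]
  exact h.dist_le hR

lemma kobayashiDist_triangle (hM : IsEmbeddedComplexSubmanifold M) (hconn : IsConnected M)
    (hz : z ∈ M) (hw : w ∈ M) (hv : v ∈ M) :
    kobayashiDist M z v ≤ kobayashiDist M z w + kobayashiDist M w v := by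
  refine le_of_forall_pos_le_add fun ε hε => ?_
  obtain ⟨ℓ, hℓ, h⟩ := exists_discChain_lt hM hconn hz hw (lt_add_of_pos_right _ (half_pos hε))
  obtain ⟨L, hL, h'⟩ := exists_discChain_lt hM hconn hw hv (lt_add_of_pos_right _ (half_pos hε))
  have := (h.trans h').kobayashiDist_le
  linarith

end Chain

section Space

/-- `M` is a bounded connected embedded complex submanifold. -/
class IsBoundedSubmanifold (M : Set (EuclideanSpace ℂ (Fin d))) : Prop where
  isBounded : Bornology.IsBounded M
  isConnected : IsConnected M
  isEmbedded : IsEmbeddedComplexSubmanifold M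

/-- A copy of the subtype of `M`, which carries the Kobayashi metric in place of the Euclidean
one. -/
def KobayashiSpace (M : Set (EuclideanSpace ℂ (Fin d))) : Type := M

namespace KobayashiSpace

variable {M : Set (EuclideanSpace ℂ (Fin d))}

/-- The inclusion of `M` into the ambient space. -/
def incl (z : KobayashiSpace M) : EuclideanSpace ℂ (Fin d) := Subtype.val z

/-- A point of the set `M`, as a point of the metric space. -/
def mk (z : EuclideanSpace ℂ (Fin d)) (hz : z ∈ M) : KobayashiSpace M := Subtype.mk z hz

lemma incl_mem (z : KobayashiSpace M) : z.incl ∈ M := Subtype.property z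

lemma incl_mk {z : EuclideanSpace ℂ (Fin d)} (hz : z ∈ M) : (mk z hz).incl = z := rfl

lemma range_incl : range (incl : KobayashiSpace M → EuclideanSpace ℂ (Fin d)) = M :=
  Subtype.range_coe

instance : TopologicalSpace (KobayashiSpace M) := inferInstanceAs (TopologicalSpace M)

lemma isEmbedding_incl : IsEmbedding (incl : KobayashiSpace M → EuclideanSpace ℂ (Fin d)) :=
  IsEmbedding.subtypeVal

lemma isCompact_preimage_incl {K : Set (EuclideanSpace ℂ (Fin d))} (hKM : K ⊆ M)
    (hK : IsCompact K) : IsCompact (incl ⁻¹' K : Set (KobayashiSpace M)) := by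
  rw [isEmbedding_incl.isInducing.isCompact_iff, image_preimage_eq_inter_range, range_incl,
    inter_eq_self_of_subset_left hKM]
  exact hK

lemma nhdsWithin_incl (z : KobayashiSpace M) : 𝓝[M] z.incl = map incl (𝓝 z) :=
  nhdsWithin_eq_map_subtype_coe z.incl_mem

variable [hM : IsBoundedSubmanifold M]

instance : Nonempty (KobayashiSpace M) := hM.isConnected.nonempty.to_subtype

/-- The Kobayashi metric. It induces the subspace topology: it dominates a multiple of the Euclidean
distance because `M` is bounded, and it is small on small Euclidean balls because these are filled
by discs. -/
noncomputable instance : MetricSpace (KobayashiSpace M) :=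
  MetricSpace.ofDistTopology (fun z w => kobayashiDist M z.incl w.incl)
    (fun z => le_antisymm (DiscChain.nil z.incl).kobayashiDist_le (kobayashiDist_nonneg _ _ _))
    (fun z w => kobayashiDist_comm M z.incl w.incl)
    (fun x y z => kobayashiDist_triangle hM.isEmbedded hM.isConnected x.incl_mem y.incl_mem
      z.incl_mem)
    (fun s => by
      obtain ⟨R, hR0, hR⟩ := hM.isBounded.subset_closedBall_lt 0 0
      rw [isOpen_iff_mem_nhds]
      refine forall₂_congr fun x hx => ⟨fun h => ?_, fun ⟨ε, hε, h⟩ => ?_⟩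
      · rw [isEmbedding_incl.nhds_eq_comap, mem_comap] at h
        obtain ⟨t, ht, hts⟩ := h
        obtain ⟨ε, hε, h⟩ := Metric.mem_nhds_iff.1 ht
        refine ⟨ε / (2 * R), by positivity, fun y hy => hts (h ?_)⟩
        rw [lt_div_iff₀' (by positivity)] at hy
        rw [Metric.mem_ball, dist_comm]
        exact (dist_le_kobayashiDist hM.isEmbedded hM.isConnected hR0 hR x.incl_mem
          y.incl_mem).trans_lt hy
      · have h1 := hM.isEmbedded.eventually_discChain x.incl_mem hε
        rw [nhdsWithin_incl, eventually_map] at h1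
        filter_upwards [h1] with y hy
        obtain ⟨ℓ, hℓ, hc⟩ := hy
        exact h y (hc.kobayashiDist_le.trans_lt hℓ))
    (fun x y h => by
      obtain ⟨R, hR0, hR⟩ := hM.isBounded.subset_closedBall_lt 0 0
      have := dist_le_kobayashiDist hM.isEmbedded hM.isConnected hR0 hR x.incl_mem y.incl_mem
      rw [h, mul_zero] at this
      exact isEmbedding_incl.injective (dist_le_zero.1 this))

lemma dist_eq (z w : KobayashiSpace M) : dist z w = kobayashiDist M z.incl w.incl := rfl

lemma isCompact_closure_range_incl :
    IsCompact (closure (range (incl : KobayashiSpace M → EuclideanSpace ℂ (Fin d)))) := by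
  rw [range_incl]
  exact hM.isBounded.isCompact_closure

instance : LocallyCompactSpace (KobayashiSpace M) := by
  have : WeaklyLocallyCompactSpace (KobayashiSpace M) := by
    refine ⟨fun p => ?_⟩
    obtain ⟨n, h⟩ := hM.isEmbedded
    obtain ⟨φ, L, -, hps, hφ, hφs, hML⟩ := h p.incl p.incl_mem
    obtain ⟨r, hr, hball⟩ := Metric.nhds_basis_closedBall.mem_iff.1
      (φ.open_source.mem_nhds hps)
    refine ⟨incl ⁻¹' Metric.closedBall p.incl r, ?_,
      isEmbedding_incl.continuous.continuousAt.preimage_mem_nhds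
        (Metric.closedBall_mem_nhds _ hr)⟩
    rw [isEmbedding_incl.isInducing.isCompact_iff, image_preimage_eq_inter_range, range_incl]
    have h1 : Metric.closedBall p.incl r ∩ M = Metric.closedBall p.incl r ∩ φ ⁻¹' L := by
      ext z
      exact and_congr_right fun hz => hML z (hball hz)
    rw [h1]
    exact (isCompact_closedBall _ _).of_isClosed_subset
      ((φ.continuousOn.mono hball).preimage_isClosed_of_isClosed Metric.isClosed_closedBall
        L.closed_of_finiteDimensional) inter_subset_left
  infer_instance

end KobayashiSpace

end Space

open KobayashiSpace

/-! ### Curves of unit speed and almost-geodesics -/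

/-- A curve in `M` on `[a, b]` of at most unit speed: any two of its points are linked by a chain of
discs whose length is the parameter distance, and outside a countable set of parameters the
Kobayashi–Royden speed is at most one. -/
structure IsUnitCurve (M : Set (EuclideanSpace ℂ (Fin d))) (a b : ℝ)
    (γ : ℝ → EuclideanSpace ℂ (Fin d)) : Prop where
  mapsTo : MapsTo γ (Icc a b) M
  chain : ∀ s ∈ Icc a b, ∀ t ∈ Icc a b, s ≤ t → DiscChain M (γ s) (γ t) (t - s)
  speed : ∃ S : Set ℝ, S.Countable ∧ ∀ t ∈ Icc a b \ S, kobayashiRoyden M (γ t) (deriv γ t) ≤ 1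

section Curves

variable {M : Set (EuclideanSpace ℂ (Fin d))} {z w : EuclideanSpace ℂ (Fin d)} {a b ℓ κ : ℝ}
  {γ : ℝ → EuclideanSpace ℂ (Fin d)}

lemma IsHolomorphicDisc.isUnitCurve {f : ℂ → EuclideanSpace ℂ (Fin d)}
    (hf : IsHolomorphicDisc M f) (a b : ℝ) :
    IsUnitCurve M a b fun t => f (Real.tanh t) :=
  ⟨fun t _ => hf.2 (ofReal_tanh_mem_ball t), fun _ _ _ _ hst => DiscChain.of_tanh hf hst,
    ∅, countable_empty, fun t _ => hf.kobayashiRoyden_tanh_le t⟩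

lemma IsUnitCurve.kobayashiDist_le (hγ : IsUnitCurve M a b γ) {s t : ℝ} (hs : s ∈ Icc a b)
    (ht : t ∈ Icc a b) : kobayashiDist M (γ s) (γ t) ≤ |s - t| := by
  rcases le_total s t with h | h
  · rw [abs_sub_comm, abs_of_nonneg (sub_nonneg.2 h)]
    exact (hγ.chain s hs t ht h).kobayashiDist_le
  · rw [abs_of_nonneg (sub_nonneg.2 h)]
    exact (hγ.chain t ht s hs h).symm.kobayashiDist_le

/-- A chain of discs is traversed by a curve of unit speed. -/
lemma DiscChain.exists_isUnitCurve (h : DiscChain M z w ℓ) (hz : z ∈ M) :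
    ∃ γ, IsUnitCurve M 0 ℓ γ ∧ γ 0 = z ∧ γ ℓ = w := by
  induction h with
  | nil z =>
    refine ⟨fun _ => z, ⟨fun _ _ => hz, ?_, {0}, countable_singleton 0, ?_⟩, rfl, rfl⟩
    · rintro s ⟨h1, h2⟩ t ⟨h3, h4⟩ -
      rw [le_antisymm h4 h3, le_antisymm h2 h1, sub_zero]
      exact DiscChain.nil z
    · rintro t ⟨⟨h1, h2⟩, h3⟩
      exact absurd (le_antisymm h2 h1) h3
  | @cons g ℓ L w hg hℓ h ih =>
    obtain ⟨γ, hγ, h0, h1⟩ := ih (hg.2 (ofReal_tanh_mem_ball ℓ))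
    have hL := h.nonneg
    obtain ⟨S, hS, hspeed⟩ := hγ.speed
    set c : ℝ → EuclideanSpace ℂ (Fin d) :=
      fun t => if t ≤ ℓ then g (Real.tanh t) else γ (t - ℓ)
    have hle : ∀ {t}, t ≤ ℓ → c t = g (Real.tanh t) := fun h => if_pos h
    have hgt : ∀ {t}, ℓ < t → c t = γ (t - ℓ) := fun h => if_neg (not_le.2 h)
    refine ⟨c, ⟨?_, ?_, ?_⟩, ?_, ?_⟩
    · intro t ht
      rcases le_or_gt t ℓ with h | h
      · rw [hle h]
        exact hg.2 (ofReal_tanh_mem_ball t)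
      · rw [hgt h]
        exact hγ.mapsTo ⟨by linarith, by linarith [ht.2]⟩
    · intro s hs t ht hst
      rcases le_or_gt t ℓ with htℓ | htℓ
      · rw [hle htℓ, hle (hst.trans htℓ)]
        exact DiscChain.of_tanh hg hst
      · rw [hgt htℓ]
        rcases le_or_gt s ℓ with hsℓ | hsℓ
        · rw [hle hsℓ]
          have h2 := hγ.chain 0 ⟨le_rfl, hL⟩ (t - ℓ) ⟨by linarith, by linarith [ht.2]⟩
            (by linarith)
          rw [h0] at h2
          have h3 := (DiscChain.of_tanh hg hsℓ).trans h2
          rwa [show ℓ - s + (t - ℓ - 0) = t - s by ring] at h3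
        · rw [hgt hsℓ]
          have h2 := hγ.chain (s - ℓ) ⟨by linarith, by linarith [hs.2]⟩ (t - ℓ)
            ⟨by linarith, by linarith [ht.2]⟩ (by linarith)
          rwa [show t - ℓ - (s - ℓ) = t - s by ring] at h2
    · refine ⟨insert ℓ ((fun t => t + ℓ) '' S), (hS.image _).insert ℓ, ?_⟩
      rintro t ⟨ht, htS⟩
      rw [mem_insert_iff, not_or] at htS
      rcases lt_or_gt_of_ne htS.1 with h | h
      · have he : c =ᶠ[𝓝 t] fun t : ℝ => g (Real.tanh t) :=
          (eventually_lt_nhds h).mono fun s hs => hle hs.le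
        rw [he.deriv_eq, hle h.le]
        exact hg.kobayashiRoyden_tanh_le t
      · have he : c =ᶠ[𝓝 t] fun t => γ (t - ℓ) :=
          (eventually_gt_nhds h).mono fun s hs => hgt hs
        rw [he.deriv_eq, hgt h, deriv_comp_sub_const]
        refine hspeed _ ⟨⟨by linarith, by linarith [ht.2]⟩, fun hmem => htS.2 ⟨_, hmem, ?_⟩⟩
        ring
    · rw [hle hℓ, Real.tanh_zero, Complex.ofReal_zero]
    · rcases hL.eq_or_lt with h | h
      · rw [hle (by linarith), ← h1, ← h, add_zero, h0]
      · rw [hgt (by linarith), add_sub_cancel_left, h1]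

/-- A curve of unit speed that is minimal up to the error `κ` is a `(1, κ)`-almost-geodesic. In
particular this holds for every curve of unit speed and of length at most `κ`. -/
lemma IsUnitCurve.isAlmostGeodesic [hM : IsBoundedSubmanifold M] (hγ : IsUnitCurve M a b γ)
    (hab : a ≤ b)
    (hκ : b - a ≤ kobayashiDist M (γ a) (γ b) + κ) : IsAlmostGeodesic M 1 κ a b γ := by
  have ha : a ∈ Icc a b := ⟨le_rfl, hab⟩
  have hb : b ∈ Icc a b := ⟨hab, le_rfl⟩
  have hκ0 : 0 ≤ κ := by
    have := (hγ.chain a ha b hb hab).kobayashiDist_le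
    linarith
  have hlow : ∀ s ∈ Icc a b, ∀ t ∈ Icc a b, s ≤ t →
      t - s - κ ≤ kobayashiDist M (γ s) (γ t) := by
    intro s hs t ht hst
    have h1 := (hγ.chain a ha s hs hs.1).kobayashiDist_le
    have h2 := (hγ.chain t ht b hb ht.2).kobayashiDist_le
    have h3 := kobayashiDist_triangle hM.isEmbedded hM.isConnected (hγ.mapsTo ha)
      (hγ.mapsTo hs) (hγ.mapsTo hb)
    have h4 := kobayashiDist_triangle hM.isEmbedded hM.isConnected (hγ.mapsTo hs)
      (hγ.mapsTo ht) (hγ.mapsTo hb)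
    linarith
  refine ⟨hγ.mapsTo, fun s hs t ht => ⟨?_, ?_⟩, ?_, ?_⟩
  · rw [div_one, one_mul]
    rcases le_total s t with h | h
    · rw [kobayashiDist_comm, abs_of_nonneg (sub_nonneg.2 h)]
      exact hlow s hs t ht h
    · rw [abs_sub_comm, abs_of_nonneg (sub_nonneg.2 h)]
      exact hlow t ht s hs h
  · have := hγ.kobayashiDist_le ht hs
    linarith
  · obtain ⟨R, hR0, hR⟩ := hM.isBounded.subset_closedBall_lt 0 0
    refine LipschitzOnWith.absolutelyContinuousOnInterval (K := (2 * R).toNNReal) ?_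
    rw [uIcc_of_le hab]
    refine LipschitzOnWith.of_dist_le_mul fun s hs t ht => ?_
    rw [Real.coe_toNNReal _ (by positivity), Real.dist_eq]
    exact (dist_le_kobayashiDist hM.isEmbedded hM.isConnected hR0 hR (hγ.mapsTo hs)
      (hγ.mapsTo ht)).trans (mul_le_mul_of_nonneg_left (hγ.kobayashiDist_le hs ht) (by positivity))
  · obtain ⟨S, hS, hspeed⟩ := hγ.speed
    rw [ae_restrict_iff' measurableSet_Icc]
    filter_upwards [hS.ae_notMem volume] with t htS ht
    rw [ENNReal.ofReal_one]
    exact hspeed t ⟨ht, htS⟩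

end Curves

/-! ### Holomorphic self-maps -/

section SelfMap

variable {M : Set (EuclideanSpace ℂ (Fin d))}

open Classical in
/-- A self-map of `M`, extended by the identity to the ambient space. -/
noncomputable def extendSelfMap (F : KobayashiSpace M → KobayashiSpace M)
    (z : EuclideanSpace ℂ (Fin d)) : EuclideanSpace ℂ (Fin d) :=
  if h : z ∈ M then (F (mk z h)).incl else z

lemma extendSelfMap_incl (F : KobayashiSpace M → KobayashiSpace M) (z : KobayashiSpace M) :
    extendSelfMap F z.incl = (F z).incl := dif_pos z.incl_mem

lemma extendSelfMap_iterate (F : KobayashiSpace M → KobayashiSpace M) (n : ℕ)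
    (z : KobayashiSpace M) : (extendSelfMap F)^[n] z.incl = (F^[n] z).incl := by
  have h : Function.Semiconj (incl : KobayashiSpace M → EuclideanSpace ℂ (Fin d)) F
      (extendSelfMap F) := fun z => (extendSelfMap_incl F z).symm
  exact ((h.iterate_right n) z).symm

lemma IsHolomorphicDisc.extendSelfMap_comp {F : KobayashiSpace M → KobayashiSpace M}
    (hF : IsHolomorphicSelfMap M F) {f : ℂ → EuclideanSpace ℂ (Fin d)}
    (hf : IsHolomorphicDisc M f) : IsHolomorphicDisc M (extendSelfMap F ∘ f) := by
  refine ⟨fun ζ hζ => ?_, fun ζ hζ => ?_⟩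
  · obtain ⟨U, G, hU, hpU, hG, hGF⟩ := hF (mk (f ζ) (hf.2 hζ))
    have hfd : DifferentiableAt ℂ f ζ := hf.1.differentiableAt (Metric.isOpen_ball.mem_nhds hζ)
    have hGd : DifferentiableAt ℂ G (f ζ) := hG.differentiableAt (hU.mem_nhds hpU)
    refine ((hGd.comp ζ hfd).congr_of_eventuallyEq ?_).differentiableWithinAt
    filter_upwards [hfd.continuousAt.preimage_mem_nhds (hU.mem_nhds hpU),
      Metric.isOpen_ball.mem_nhds hζ] with η hη hη'
    exact (extendSelfMap_incl F (mk (f η) (hf.2 hη'))).trans (hGF (mk (f η) (hf.2 hη')) hη).symm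
  · have := extendSelfMap_incl F (mk (f ζ) (hf.2 hζ))
    rw [incl_mk] at this
    rw [Function.comp_apply, this]
    exact incl_mem _

lemma IsHolomorphicDisc.extendSelfMap_iterate_comp {F : KobayashiSpace M → KobayashiSpace M}
    (hF : IsHolomorphicSelfMap M F) {f : ℂ → EuclideanSpace ℂ (Fin d)} (hf : IsHolomorphicDisc M f)
    (n : ℕ) : IsHolomorphicDisc M ((extendSelfMap F)^[n] ∘ f) := by
  induction n with
  | zero => exact hf
  | succ n ih =>
    rw [Function.iterate_succ', Function.comp_assoc]
    exact ih.extendSelfMap_comp hF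

/-- A property of points of `M` that propagates along discs holds everywhere if it holds at one
point. -/
lemma IsEmbeddedComplexSubmanifold.disc_induction (hM : IsEmbeddedComplexSubmanifold M)
    (hconn : IsConnected M) {P : EuclideanSpace ℂ (Fin d) → Prop}
    (hP : ∀ g, IsHolomorphicDisc M g → ∀ ℓ, 0 ≤ ℓ → P (g 0) → P (g (Real.tanh ℓ)))
    {z w : EuclideanSpace ℂ (Fin d)} (hz : z ∈ M) (hw : w ∈ M) (h : P z) : P w := by
  obtain ⟨ℓ, hc⟩ := hM.exists_discChain hconn hz hw
  clear hz hw
  induction hc with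
  | nil z => exact h
  | cons hg hℓ _ ih => exact ih (hP _ hg _ hℓ h)

lemma lipschitzWith_of_isHolomorphicSelfMap [hM : IsBoundedSubmanifold M]
    {F : KobayashiSpace M → KobayashiSpace M} (hF : IsHolomorphicSelfMap M F) :
    LipschitzWith 1 F := by
  refine LipschitzWith.mk_one fun x y => ?_
  refine le_of_forall_pos_le_add fun ε hε => ?_
  obtain ⟨ℓ, hℓ, h⟩ := exists_discChain_lt hM.isEmbedded hM.isConnected x.incl_mem y.incl_mem
    (lt_add_of_pos_right (kobayashiDist M x.incl y.incl) hε)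
  have h1 := h.map fun f hf => hf.extendSelfMap_comp hF
  rw [extendSelfMap_incl, extendSelfMap_incl] at h1
  exact h1.kobayashiDist_le.trans hℓ.le

end SelfMap

/-! ### Taut submanifolds with visible almost-geodesics -/

section Taut

variable {M : Set (EuclideanSpace ℂ (Fin d))} [hM : IsBoundedSubmanifold M]

/-- Since almost minimal curves of unit speed are `(1, κ)`-almost-geodesics with arbitrarily small
error, their visibility yields points exactly between `x` and `y` in the limit. -/
lemma isVisibleEmbedding_of_almostGeodesics {κ : ℝ} (hκ : 0 < κ)
    (hbend : CurvesBend M (IsAlmostGeodesic M 1 κ)) :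
    IsVisibleEmbedding (incl : KobayashiSpace M → EuclideanSpace ℂ (Fin d)) := by
  intro p hp q hq hpq
  rw [range_incl] at hp hq
  obtain ⟨V, hV, W, hW, -, K, hKM, hK, hcurves⟩ := hbend p hp q hq hpq
  refine ⟨V, hV, W, hW, incl ⁻¹' K, isCompact_preimage_incl hKM hK, fun x y hx hy => ?_⟩
  have key : ∀ ε, 0 < ε → ∃ u ∈ (incl ⁻¹' K : Set (KobayashiSpace M)),
      dist x u + dist u y ≤ dist x y + ε := by
    intro ε hε
    obtain ⟨ℓ, hℓ, h⟩ := exists_discChain_lt hM.isEmbedded hM.isConnected x.incl_mem y.incl_mem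
      (lt_add_of_pos_right (kobayashiDist M x.incl y.incl) (lt_min hε hκ))
    obtain ⟨γ, hγ, h0, h1⟩ := h.exists_isUnitCurve x.incl_mem
    have hmin1 := min_le_left ε κ
    have hmin2 := min_le_right ε κ
    have hℓ0 := h.nonneg
    obtain ⟨t, ht, htK⟩ := hcurves 0 ℓ γ hℓ0 (hγ.isAlmostGeodesic hℓ0
      (by rw [h0, h1]; linarith)) (by rwa [h0]) (by rwa [h1])
    refine ⟨mk (γ t) (hKM htK), htK, ?_⟩
    have h2 := (hγ.chain 0 ⟨le_rfl, hℓ0⟩ t ht ht.1).kobayashiDist_le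
    have h3 := (hγ.chain t ht ℓ ⟨hℓ0, le_rfl⟩ ht.2).kobayashiDist_le
    rw [h0] at h2
    rw [h1] at h3
    simp only [dist_eq, incl_mk]
    linarith
  obtain ⟨u₀, hu₀, -⟩ := key 1 one_pos
  obtain ⟨u, hu, hmin⟩ := (isCompact_preimage_incl hKM hK).exists_isMinOn ⟨u₀, hu₀⟩
    (f := fun u => dist x u + dist u y) (by fun_prop)
  refine ⟨u, hu, le_of_forall_pos_le_add fun ε hε => ?_⟩
  obtain ⟨v, hv, hle⟩ := key ε hε
  exact (hmin hv).trans hle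

/-- Short curves of unit speed are `(1, κ)`-almost-geodesics. Their images under the iterates are
short as well and leave every compact set, so visibility forbids that their end points tend to
distinct boundary points. -/
lemma hasCommonLimits_of_almostGeodesics {κ : ℝ} (hκ : 0 < κ)
    (hbend : CurvesBend M (IsAlmostGeodesic M 1 κ)) {F : KobayashiSpace M → KobayashiSpace M}
    (hF : IsHolomorphicSelfMap M F) (hesc : ∀ x, OrbitEscapes F x) :
    HasCommonLimits (incl : KobayashiSpace M → EuclideanSpace ℂ (Fin d)) F := by
  have hL := lipschitzWith_of_isHolomorphicSelfMap hF
  intro 𝒰 h𝒰 ξ hξ x y hx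
  set Φ := extendSelfMap F
  have hshort : ∀ g, IsHolomorphicDisc M g → ∀ s t : ℝ, s ≤ t → t ≤ s + κ →
      Tendsto (fun n => Φ^[n] (g (Real.tanh s))) 𝒰 (𝓝 ξ) →
      Tendsto (fun n => Φ^[n] (g (Real.tanh t))) 𝒰 (𝓝 ξ) := by
    intro g hg s t hst hts hs
    have hmem : ∀ τ : ℝ, g (Real.tanh τ) ∈ M := fun τ => hg.2 (ofReal_tanh_mem_ball τ)
    obtain ⟨η, hη, hlim⟩ := exists_tendsto_boundary isEmbedding_incl
      isCompact_closure_range_incl (hesc (mk _ (hmem t))) (fun n => F^[n] (mk _ (hmem t))) h𝒰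
      (by simp only [dist_self, tendsto_const_nhds])
    simp only [← extendSelfMap_iterate, incl_mk] at hlim
    by_cases hne : ξ = η
    · rwa [hne]
    rw [range_incl] at hξ hη
    obtain ⟨V, hV, W, hW, -, K, hKM, hK, hcurves⟩ := hbend ξ hξ η hη hne
    set σ : ℝ → KobayashiSpace M := fun τ => mk (g (Real.tanh τ)) (hmem τ)
    have hσ : Continuous σ := by
      refine isEmbedding_incl.continuous_iff.2 (continuous_iff_continuousAt.2 fun τ => ?_)
      have h1 : ContinuousAt g (Real.tanh τ) :=
        (hg.1.differentiableAt (Metric.isOpen_ball.mem_nhds (ofReal_tanh_mem_ball τ))).continuousAt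
      have h2 : ContinuousAt (fun τ : ℝ => (Real.tanh τ : ℂ)) τ :=
        (hasDerivAt_tanh τ).ofReal_comp.continuousAt
      exact ContinuousAt.comp (f := fun τ : ℝ => (Real.tanh τ : ℂ)) h1 h2
    have hleave := eventually_forall_notMem_of_orbitEscapes hL hesc
      ((isCompact_Icc (a := s) (b := t)).image hσ) (isCompact_preimage_incl hKM hK)
    obtain ⟨n, ⟨hn1, hn2⟩, hn3⟩ := (((hs.eventually_mem hV).and (hlim.eventually_mem hW)).and
      (h𝒰 hleave)).exists
    have hu := (hg.extendSelfMap_iterate_comp hF n).isUnitCurve s t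
    obtain ⟨τ, hτ, hτK⟩ := hcurves s t _ hst (hu.isAlmostGeodesic hst
      (by
        have := kobayashiDist_nonneg M ((Φ^[n] ∘ g) (Real.tanh s)) ((Φ^[n] ∘ g) (Real.tanh t))
        linarith)) hn1 hn2
    refine absurd ?_ (hn3 (σ τ) ⟨τ, hτ, rfl⟩)
    rw [mem_preimage, ← extendSelfMap_iterate]
    exact hτK
  have hstep : ∀ g, IsHolomorphicDisc M g → ∀ ℓ, 0 ≤ ℓ →
      Tendsto (fun n => Φ^[n] (g 0)) 𝒰 (𝓝 ξ) →
      Tendsto (fun n => Φ^[n] (g (Real.tanh ℓ))) 𝒰 (𝓝 ξ) := by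
    intro g hg ℓ hℓ h0
    obtain ⟨N, hN⟩ := exists_nat_gt (ℓ / κ)
    have hN0 : (0 : ℝ) < N := (by positivity : (0 : ℝ) ≤ ℓ / κ).trans_lt hN
    have hle : ℓ / N ≤ κ := by
      rw [div_lt_iff₀ hκ] at hN
      rw [div_le_iff₀ hN0]
      linarith
    have h : ∀ i : ℕ, Tendsto (fun n => Φ^[n] (g (Real.tanh (i * (ℓ / N))))) 𝒰 (𝓝 ξ) := by
      intro i
      induction i with
      | zero => simpa using h0
      | succ i ih =>
        have h1 : ((i + 1 : ℕ) : ℝ) * (ℓ / N) = i * (ℓ / N) + ℓ / N := by push_cast; ring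
        refine hshort g hg _ _ ?_ ?_ ih
        · rw [h1]
          have : 0 ≤ ℓ / N := by positivity
          linarith
        · rw [h1]
          linarith
    have := h N
    rwa [mul_div_cancel₀ _ hN0.ne'] at this
  have h1 : Tendsto (fun n => Φ^[n] x.incl) 𝒰 (𝓝 ξ) := by
    simpa only [Φ, extendSelfMap_iterate] using hx
  have h2 := hM.isEmbedded.disc_induction hM.isConnected
    (P := fun z => Tendsto (fun n => Φ^[n] z) 𝒰 (𝓝 ξ)) hstep x.incl_mem y.incl_mem h1
  simpa only [Φ, extendSelfMap_iterate] using h2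

/-- In a taut submanifold, one relatively compact orbit forces all orbits to be relatively compact:
the images of a disc under the iterates cannot be compactly divergent. -/
lemma hasCompactOrbit_of_isTaut (htaut : IsTaut M) {F : KobayashiSpace M → KobayashiSpace M}
    (hF : IsHolomorphicSelfMap M F) {x : KobayashiSpace M} (hx : HasCompactOrbit F x)
    (y : KobayashiSpace M) : HasCompactOrbit F y := by
  have hL := lipschitzWith_of_isHolomorphicSelfMap hF
  suffices h : ∃ h : y.incl ∈ M, HasCompactOrbit F (mk y.incl h) from h.2
  refine hM.isEmbedded.disc_induction hM.isConnected
    (P := fun z => ∃ h : z ∈ M, HasCompactOrbit F (mk z h)) (fun g hg ℓ hℓ ⟨h0, K, hK, hKg⟩ => ?_)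
    x.incl_mem y.incl_mem ⟨x.incl_mem, hx⟩
  have hmem : g (Real.tanh ℓ) ∈ M := hg.2 (ofReal_tanh_mem_ball ℓ)
  refine ⟨hmem, (hasCompactOrbit_or_orbitEscapes hL _).resolve_right fun hesc => ?_⟩
  obtain ⟨φ, hφ, ⟨h, hh, hlim⟩ | hdiv⟩ := htaut (fun n => (extendSelfMap F)^[n] ∘ g)
    (fun n => hg.extendSelfMap_iterate_comp hF n)
  · have h1 := hlim.tendsto_at (ofReal_tanh_mem_ball ℓ)
    simp only [Function.comp_apply] at h1
    have h2 : Tendsto (fun n => F^[φ n] (mk (g (Real.tanh ℓ)) hmem)) atTop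
        (𝓝 (mk (h (Real.tanh ℓ)) (hh.2 (ofReal_tanh_mem_ball ℓ)))) := by
      rw [isEmbedding_incl.tendsto_nhds_iff]
      simpa only [Function.comp_def, ← extendSelfMap_iterate, incl_mk] using h1
    obtain ⟨H, hH, hHn⟩ := exists_compact_mem_nhds
      (mk (h (Real.tanh ℓ)) (hh.2 (ofReal_tanh_mem_ball ℓ)))
    obtain ⟨n, hn1, hn2⟩ := ((h2.eventually_mem hHn).and
      (hφ.tendsto_atTop.eventually (hesc H hH))).exists
    exact hn2 hn1
  · obtain ⟨n, hn⟩ := (hdiv {0} (by simp) isCompact_singleton (incl '' K)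
      (image_subset_iff.2 fun z _ => z.incl_mem) (hK.image isEmbedding_incl.continuous)).exists
    refine disjoint_left.1 hn (mem_image_of_mem _ (mem_singleton _)) ?_
    have := extendSelfMap_iterate F (φ n) (mk (g 0) h0)
    exact ⟨_, hKg (φ n), this.symm⟩

end Taut

/-! ### Complete submanifolds with visible geodesics -/

section Complete

variable {M : Set (EuclideanSpace ℂ (Fin d))} [hM : IsBoundedSubmanifold M]

lemma hasAlmostMinimalCurves : HasAlmostMinimalCurves (KobayashiSpace M) := by
  intro x y r hr
  obtain ⟨ℓ, hℓ, h⟩ := exists_discChain_lt hM.isEmbedded hM.isConnected x.incl_mem y.incl_mem hr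
  obtain ⟨γ, hγ, h0, h1⟩ := h.exists_isUnitCurve x.incl_mem
  have hℓ0 := h.nonneg
  -- the curve stays at its end point `y` from the time `ℓ` on
  refine ⟨fun t => mk (γ (projIcc 0 ℓ hℓ0 t)) (hγ.mapsTo (projIcc 0 ℓ hℓ0 t).2), ?_, ?_, ?_⟩
  · exact isEmbedding_incl.injective (by simp [incl_mk, h0])
  · exact isEmbedding_incl.injective (by simp [incl_mk, projIcc_of_right_le hℓ0 hℓ.le, h1])
  · intro s _ t _
    refine (hγ.kobayashiDist_le (projIcc 0 ℓ hℓ0 s).2 (projIcc 0 ℓ hℓ0 t).2).trans ?_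
    exact abs_projIcc_sub_projIcc hℓ0

lemma properSpace_of_isKobayashiComplete (hcomp : IsKobayashiComplete M)  :
    ProperSpace (KobayashiSpace M) := by
  have : CompleteSpace (KobayashiSpace M) := by
    refine Metric.complete_of_cauchySeq_tendsto fun u hu => ?_
    obtain ⟨x, hx, hlim⟩ := hcomp (fun n => (u n).incl) (fun n => (u n).incl_mem)
      (Metric.cauchySeq_iff.1 hu)
    exact ⟨mk x hx, tendsto_iff_dist_tendsto_zero.2 hlim⟩
  exact hasAlmostMinimalCurves.properSpace

lemma isVisibleEmbedding_of_geodesics (hcomp : IsKobayashiComplete M)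
    (hbend : CurvesBend M (IsRealGeodesic M)) :
    IsVisibleEmbedding (incl : KobayashiSpace M → EuclideanSpace ℂ (Fin d)) := by
  have := properSpace_of_isKobayashiComplete hcomp
  intro p hp q hq hpq
  rw [range_incl] at hp hq
  obtain ⟨V, hV, W, hW, -, K, hKM, hK, hcurves⟩ := hbend p hp q hq hpq
  refine ⟨V, hV, W, hW, incl ⁻¹' K, isCompact_preimage_incl hKM hK, fun x y hx hy => ?_⟩
  obtain ⟨σ, h0, h1, hσ⟩ := hasAlmostMinimalCurves.exists_geodesic x y
  have hL : 0 ≤ dist x y := dist_nonneg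
  obtain ⟨t, ht, htK⟩ := hcurves 0 (dist x y) (fun t => (σ t).incl) hL
    ⟨fun t _ => (σ t).incl_mem, hσ⟩ (by rwa [h0]) (by rwa [h1])
  refine ⟨σ t, htK, ?_⟩
  have h2 := hσ 0 ⟨le_rfl, hL⟩ t ht
  have h3 := hσ t ht _ ⟨hL, le_rfl⟩
  rw [h0, zero_sub, abs_neg, abs_of_nonneg ht.1] at h2
  rw [h1, abs_sub_comm, abs_of_nonneg (sub_nonneg.2 ht.2)] at h3
  linarith

end Complete

/-! ### The Wolff–Denjoy theorem -/

lemma isCompact_closure_orbit_iff {X : Type*} [MetricSpace X] (f : X → X) (x : X) :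
    IsCompact (closure {w : X | ∃ ν : ℕ, 1 ≤ ν ∧ w = f^[ν] x}) ↔ HasCompactOrbit f x := by
  constructor
  · refine fun h => ⟨insert x _, h.insert x, fun n => ?_⟩
    rcases Nat.eq_zero_or_pos n with rfl | hn
    · exact mem_insert _ _
    · exact mem_insert_of_mem _ (subset_closure ⟨n, hn, rfl⟩)
  · rintro ⟨K, hK, hx⟩
    refine hK.of_isClosed_subset isClosed_closure (closure_minimal ?_ hK.isClosed)
    rintro _ ⟨n, -, rfl⟩
    exact hx n

/-- The Wolff–Denjoy theorem, on the copy of `M` that carries the Kobayashi metric. By Całka's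
dichotomy for one orbit, and since all orbits behave alike, either all orbits are relatively compact
or all of them escape. -/
theorem wolff_denjoy {M : Set (EuclideanSpace ℂ (Fin d))} [hsub : IsBoundedSubmanifold M]
    (hM : (∃ κ : ℝ, 0 < κ ∧ IsVisibilitySubmanifold M 1 κ ∧ IsTaut M) ∨
      IsBNTVisibilitySubmanifold M)
    {F : KobayashiSpace M → KobayashiSpace M} (hF : IsHolomorphicSelfMap M F) :
    Xor
      (∀ z, IsCompact (closure {w | ∃ ν : ℕ, 1 ≤ ν ∧ w = F^[ν] z}))
      (∃ ξ ∈ bdry M, (∀ z, Tendsto (fun ν : ℕ => (F^[ν] z).incl) atTop (𝓝 ξ)) ∧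
        ∀ K : Set (KobayashiSpace M), IsCompact K →
          TendstoUniformlyOn (fun (ν : ℕ) z => (F^[ν] z).incl) (fun _ => ξ) atTop K) := by
  have hL := lipschitzWith_of_isHolomorphicSelfMap hF
  have hall : ∀ x y, HasCompactOrbit F x → HasCompactOrbit F y := by
    rcases hM with ⟨κ, hκ, -, htaut⟩ | ⟨hcomp, -⟩
    · exact fun x y hx => hasCompactOrbit_of_isTaut htaut hF hx y
    · have := properSpace_of_isKobayashiComplete hcomp
      exact fun x y hx => hx.of_properSpace hL y
  have hvis : IsVisibleEmbedding (incl : KobayashiSpace M → EuclideanSpace ℂ (Fin d)) := by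
    rcases hM with ⟨κ, hκ, ⟨-, hbend⟩, -⟩ | ⟨hcomp, hbend⟩
    · exact isVisibleEmbedding_of_almostGeodesics hκ hbend
    · exact isVisibleEmbedding_of_geodesics hcomp hbend
  have hexcl : ∀ ξ ∈ bdry M, ∀ z, Tendsto (fun ν : ℕ => (F^[ν] z).incl) atTop (𝓝 ξ) →
      ¬ HasCompactOrbit F z := by
    rintro ξ hξ z hlim ⟨K, hK, hz⟩
    obtain ⟨w, -, rfl⟩ := (hK.image isEmbedding_incl.continuous).isClosed.mem_of_tendsto hlim
      (Eventually.of_forall fun n => mem_image_of_mem incl (hz n))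
    exact hξ.2 w.incl_mem
  obtain ⟨o⟩ : Nonempty (KobayashiSpace M) := inferInstance
  rcases hasCompactOrbit_or_orbitEscapes hL o with ho | ho
  · refine Or.inl ⟨fun z => (isCompact_closure_orbit_iff F z).2 (hall o z ho), ?_⟩
    rintro ⟨ξ, hξ, hlim, -⟩
    exact hexcl ξ hξ o (hlim o) ho
  · have hesc : ∀ x, OrbitEscapes F x := fun x =>
      (hasCompactOrbit_or_orbitEscapes hL x).resolve_left fun hx =>
        not_hasCompactOrbit_of_orbitEscapes ho (hall x o hx)
    have hlim : HasCommonLimits (incl : KobayashiSpace M → EuclideanSpace ℂ (Fin d)) F := by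
      rcases hM with ⟨κ, hκ, ⟨-, hbend⟩, -⟩ | ⟨hcomp, -⟩
      · exact hasCommonLimits_of_almostGeodesics hκ hbend hF hesc
      · have := properSpace_of_isKobayashiComplete hcomp
        exact hasCommonLimits_of_properSpace isEmbedding_incl isCompact_closure_range_incl hL hvis
          hesc
    obtain ⟨ξ, hξ, hconv, hunif⟩ := exists_tendstoUniformlyOn_of_orbitEscapes isEmbedding_incl
      isCompact_closure_range_incl hL hvis hlim hesc
    rw [range_incl] at hξ
    refine Or.inr ⟨⟨ξ, hξ, hconv, hunif⟩, fun h => ?_⟩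
    exact hexcl ξ hξ o (hconv o) ((isCompact_closure_orbit_iff F o).1 (h o))

end KobayashiVisibility

theorem mainTheorem6 {d : ℕ} (M : Set (EuclideanSpace ℂ (Fin d)))
    (hbdd : Bornology.IsBounded M) (hconn : IsConnected M)
    (hsub : KobayashiVisibility.IsEmbeddedComplexSubmanifold M)
    (hM : (∃ κ₀ : ℝ, 0 < κ₀ ∧ KobayashiVisibility.IsVisibilitySubmanifold M 1 κ₀ ∧
        KobayashiVisibility.IsTaut M) ∨
      KobayashiVisibility.IsBNTVisibilitySubmanifold M)
    (F : M → M) (hF : KobayashiVisibility.IsHolomorphicSelfMap M F) :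
    Xor
      (∀ z : M, IsCompact (closure {w : M | ∃ ν : ℕ, 1 ≤ ν ∧ w = F^[ν] z}))
      (∃ ξ ∈ KobayashiVisibility.bdry M,
        (∀ z : M, Tendsto (fun ν : ℕ => (F^[ν] z : EuclideanSpace ℂ (Fin d))) atTop (𝓝 ξ)) ∧
        ∀ K : Set M, IsCompact K →
          TendstoUniformlyOn (fun (ν : ℕ) (z : M) => (F^[ν] z : EuclideanSpace ℂ (Fin d)))
            (fun _ => ξ) atTop K) := by
  have : KobayashiVisibility.IsBoundedSubmanifold M := ⟨hbdd, hconn, hsub⟩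
  -- `KobayashiSpace M` is definitionally the subtype of `M`, with the same topology
  exact KobayashiVisibility.wolff_denjoy (M := M) hM (F := F) hF
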